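/- A \emph{truly integral F\'ary embedding} of a graph is a crossing-free straight-line drawing in the Euclidean plane in which every vertex lies on a point of $\mathbb{Z}^2$ and every edge has integer Euclidean length. Crossing-free means that distinct vertices are distinct points, no edge contains a vertex other than its endpoints, and two distinct edges meet at most in a common endpoint. A drawing lies on a grid of size $A\times B$ if its vertices lie in at most $A$ consecutive columns and at most $B$ consecutive rows of $\mathbb{Z}^2$. Theorem. Let $T=(V,E)$ be a finite tree with root $r$, with $n$ vertices, $t$ leaves (vertices without children) and depth $d$ (the largest distance of a vertex from $r$). Then $T$ has a truly integral F\'ary embedding on a grid of size $S\times S$, where $S=\frac{2\pi^2}{3}\,t\,d$ if $n\ge 2$, and $S=1$ if $n=1$ (a single vertex, $d=0$). Moreover $S\in\mathcal{O}(n^2)$, with an absolute constant. Such an embedding can be found in $\mathcal{O}(n+t^{3/2})$ time: there is a program for a random access machine with words of $\mathcal{O}(\log n)$ bits and unit-cost arithmetic, memory access and comparison that, given the root and the adjacency lists of any such tree on the vertex set $\{0,\dots,n-1\}$, halts after $\mathcal{O}(n+t^{3/2})$ steps with the coordinates of all vertices of such an embedding in its memory. -/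

import Mathlib

universe u

/-! ### Rooted trees -/

namespace RootedTree

variable {V : Type u}

/-- In the tree `G` rooted at `r`, the vertex `w` is a child of `v`. -/
def IsChild (G : SimpleGraph V) (r v w : V) : Prop :=
  G.Adj v w ∧ G.dist r w = G.dist r v + 1

/-- A leaf of a rooted tree is a vertex without children (so the root of a one-vertex tree is a
leaf, while a root of degree one is not). -/
def IsLeaf (G : SimpleGraph V) (r v : V) : Prop :=
  ∀ w, ¬ IsChild G r v w

/-- The number of leaves. -/
noncomputable def leafCount (G : SimpleGraph V) (r : V) : ℕ :=
  {v : V | IsLeaf G r v}.ncard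

/-- The depth: the largest distance of a vertex from the root. -/
noncomputable def depth [Fintype V] (G : SimpleGraph V) (r : V) : ℕ :=
  Finset.univ.sup fun v => G.dist r v

end RootedTree

/-! ### Straight-line drawings -/

namespace Drawing

variable {V : Type u}

/-- `P` places the vertices of `G` such that the straight-line drawing is crossing-free: distinct
vertices are distinct points, an edge contains no vertex other than its endpoints, and two distinct
edges meet at most in a common endpoint. -/
structure IsFary (G : SimpleGraph V) (P : V → EuclideanSpace ℝ (Fin 2)) : Prop where
  injective : Function.Injective P
  vertex_edge : ∀ ⦃u v w : V⦄, G.Adj u v → P w ∈ segment ℝ (P u) (P v) → w = u ∨ w = v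
  edge_edge : ∀ ⦃u v w x : V⦄, G.Adj u v → G.Adj w x → s(u, v) ≠ s(w, x) →
    ∀ p ∈ segment ℝ (P u) (P v) ∩ segment ℝ (P w) (P x),
      ∃ z, (z = u ∨ z = v) ∧ (z = w ∨ z = x) ∧ p = P z

/-- A grid point as a point of the Euclidean plane. -/
noncomputable def toPlane (p : ℤ × ℤ) : EuclideanSpace ℝ (Fin 2) :=
  !₂[(p.1 : ℝ), (p.2 : ℝ)]

/-- A crossing-free straight-line drawing with all vertices on grid points and all edge lengths
integers. -/
structure IsTrulyIntegralFary (G : SimpleGraph V) (pos : V → ℤ × ℤ) : Prop where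
  fary : IsFary G fun v => toPlane (pos v)
  integral : ∀ ⦃u v : V⦄, G.Adj u v → ∃ l : ℕ, dist (toPlane (pos u)) (toPlane (pos v)) = l

/-- All vertices lie on a `w × h` grid (`w` consecutive columns and `h` consecutive rows of grid
points) with `w ≤ A` and `h ≤ B`. -/
def OnGrid (pos : V → ℤ × ℤ) (A B : ℝ) : Prop :=
  ∃ w h : ℕ, (w : ℝ) ≤ A ∧ (h : ℝ) ≤ B ∧ ∃ a b : ℤ,
    ∀ v, (a ≤ (pos v).1 ∧ (pos v).1 < a + w) ∧ (b ≤ (pos v).2 ∧ (pos v).2 < b + h)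

end Drawing

/-! ### A random access machine with bounded words and a step count -/

namespace RAM

/-- The arithmetic operations of the machine. -/
inductive BinOp
  | add | sub | mul | div | mod

/-- Operations on natural numbers; subtraction is truncated and division rounds down. -/
def BinOp.eval : BinOp → ℕ → ℕ → ℕ
  | add, a, b => a + b
  | sub, a, b => a - b
  | mul, a, b => a * b
  | div, a, b => a / b
  | mod, a, b => a % b

/-- Programs, built from elementary instructions on registers `R i` and an indirectly addressed
memory `M`. -/
inductive Prog
  /-- Do nothing. -/
  | skip
  /-- `R i := k` -/
  | const (i k : ℕ)
  /-- `R i := R j o R k` -/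
  | op (o : BinOp) (i j k : ℕ)
  /-- `R i := M (R j)` -/
  | load (i j : ℕ)
  /-- `M (R i) := R j` -/
  | store (i j : ℕ)
  /-- First `p`, then `q`. -/
  | seq (p q : Prog)
  /-- If `R i < R j` then `p`, else `q`. -/
  | cond (i j : ℕ) (p q : Prog)
  /-- While `R i < R j` repeat `p`. -/
  | loop (i j : ℕ) (p : Prog)

/-- The contents of the registers and of the memory. -/
structure State where
  reg : ℕ → ℕ
  mem : ℕ → ℕ

/-- Write `x` into register `i`. -/
def State.setReg (s : State) (i x : ℕ) : State :=
  { s with reg := Function.update s.reg i x }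

/-- Write `x` into memory cell `a`. -/
def State.setMem (s : State) (a x : ℕ) : State :=
  { s with mem := Function.update s.mem a x }

/-- `Exec B p s s' T`: started in state `s`, the program `p` halts in state `s'` after `T` steps,
and every number that is written on the way is at most `B` (the word size is about `log₂ B` bits).
Every elementary instruction and every evaluation of a test takes one step. -/
inductive Exec (B : ℕ) : Prog → State → State → ℕ → Prop
  | skip (s : State) : Exec B .skip s s 1
  | const (s : State) (i k : ℕ) (h : k ≤ B) : Exec B (.const i k) s (s.setReg i k) 1
  | op (s : State) (o : BinOp) (i j k : ℕ) (h : o.eval (s.reg j) (s.reg k) ≤ B) :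
      Exec B (.op o i j k) s (s.setReg i (o.eval (s.reg j) (s.reg k))) 1
  | load (s : State) (i j : ℕ) (h : s.mem (s.reg j) ≤ B) :
      Exec B (.load i j) s (s.setReg i (s.mem (s.reg j))) 1
  | store (s : State) (i j : ℕ) (h : s.reg j ≤ B) :
      Exec B (.store i j) s (s.setMem (s.reg i) (s.reg j)) 1
  | seq {p q : Prog} {s s' s'' : State} {T T' : ℕ} (hp : Exec B p s s' T)
      (hq : Exec B q s' s'' T') : Exec B (.seq p q) s s'' (T + T')
  | cond_true {i j : ℕ} {p q : Prog} {s s' : State} {T : ℕ} (h : s.reg i < s.reg j)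
      (hp : Exec B p s s' T) : Exec B (.cond i j p q) s s' (T + 1)
  | cond_false {i j : ℕ} {p q : Prog} {s s' : State} {T : ℕ} (h : ¬ s.reg i < s.reg j)
      (hq : Exec B q s s' T) : Exec B (.cond i j p q) s s' (T + 1)
  | loop_false {i j : ℕ} {p : Prog} {s : State} (h : ¬ s.reg i < s.reg j) :
      Exec B (.loop i j p) s s 1
  | loop_true {i j : ℕ} {p : Prog} {s s' s'' : State} {T T' : ℕ} (h : s.reg i < s.reg j)
      (hp : Exec B p s s' T) (hl : Exec B (.loop i j p) s' s'' T') :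
      Exec B (.loop i j p) s s'' (T + T' + 1)

/-- The initial state: all registers are `0`, the memory holds the input from address `0` on and
is `0` elsewhere. -/
def State.init (input : List ℕ) : State where
  reg _ := 0
  mem a := input.getD a 0

/-- `adj v` lists the neighbours of `v`, each once, in arbitrary order. -/
def IsAdjLists {n : ℕ} (G : SimpleGraph (Fin n)) (adj : Fin n → List (Fin n)) : Prop :=
  ∀ v, (adj v).Nodup ∧ ∀ w, w ∈ adj v ↔ G.Adj v w

/-- The input for a graph on `Fin n` with root `r`, given by adjacency lists: the number `n`, the
root, for every `k ≤ n` the total length of the lists of the vertices below `k`, and the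
concatenation of the lists. -/
def encode {n : ℕ} (adj : Fin n → List (Fin n)) (r : Fin n) : List ℕ :=
  [n, r.val]
    ++ (List.range (n + 1)).map
        (fun k => (((List.finRange n).take k).map fun v => (adj v).length).sum)
    ++ (List.finRange n).flatMap (fun v => (adj v).map Fin.val)

/-- The output: the coordinates of vertex `v` stand in the memory cells `2 * v` and `2 * v + 1`. -/
def State.output (s : State) {n : ℕ} (v : Fin n) : ℤ × ℤ :=
  ((s.mem (2 * v.val) : ℤ), (s.mem (2 * v.val + 1) : ℤ))

end RAM

/-!
Let `b / a` run through the reduced fractions in `[0, 1]` in increasing order, restricted to those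
for which the coordinates of the Pythagorean vector `(a² - b², 2 * a * b)` are less than `N`. These
vectors have integer length and increasing slope. Number the leaves of the tree in preorder and let
the edge from the parent of `u` to `u` be the vector with the index of the first leaf below `u`.
Along any downward path the indices stay inside the block of leaves of the subtree, so siblings are
drawn in disjoint cones with apex at their parent, and the drawing is crossing-free. Since the
totients up to `m` sum to at least `m² / 4`, the value `N = 13 * t / 2` yields at least `t` vectors,
and `13 / 2 ≤ 2 * π² / 3`.

For the running time, a stack of pending vertices produces the preorder. A new vector is needed only
at a leaf, and the next fraction is found by scanning its `O(√t)` possible denominators.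
-/

/-! ### The summatory function of the totient -/

namespace Fractions

open Finset

/-- The summatory function of Euler's totient, which counts the fractions in `[0, 1)` whose reduced
denominator is at most `x`. -/
def totientSum (x : ℕ) : ℕ := ∑ a ∈ Ioc 0 x, Nat.totient a

theorem two_mul_sum_Ioc_id (x : ℕ) : 2 * ∑ n ∈ Ioc 0 x, n = x * (x + 1) := by
  induction x with
  | zero => simp
  | succ x ih => rw [sum_Ioc_succ_top (Nat.zero_le x), mul_add, ih]; ring

theorem two_mul_sum_totientSum_div (x : ℕ) :
    2 * ∑ d ∈ Ioc 0 x, totientSum (x / d) = x * (x + 1) := by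
  let φ : ArithmeticFunction ℕ := ⟨Nat.totient, Nat.totient_zero⟩
  have zeta_mul_φ (n : ℕ) : (ArithmeticFunction.zeta * φ) n = n := by
    simpa only [ArithmeticFunction.natCoe_nat] using
      (ArithmeticFunction.coe_zeta_mul_apply (f := φ) (x := n)).trans n.sum_totient
  rw [← two_mul_sum_Ioc_id, ← sum_congr rfl fun n _ => zeta_mul_φ n,
    ArithmeticFunction.sum_Ioc_mul_eq_sum_sum]
  congr 1
  refine sum_congr rfl fun d hd => ?_
  rw [ArithmeticFunction.zeta_apply_ne (mem_Ioc.1 hd).1.ne', one_mul]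
  rfl

theorem sum_Ioc_eq_sum_odd_add_sum_even {M : Type*} [AddCommMonoid M] (f : ℕ → M) (x : ℕ) :
    ∑ d ∈ Ioc 0 x, f d
      = ∑ i ∈ range ((x + 1) / 2), f (2 * i + 1) + ∑ d ∈ Ioc 0 (x / 2), f (2 * d) := by
  induction x with
  | zero => simp
  | succ x ih =>
    rw [sum_Ioc_succ_top (Nat.zero_le x), ih]
    obtain ⟨k, rfl | rfl⟩ := Nat.even_or_odd' x
    · rw [show (2 * k + 1 + 1) / 2 = k + 1 by omega, show (2 * k + 1) / 2 = k by omega,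
        show 2 * k / 2 = k by omega, sum_range_succ, add_right_comm]
    · rw [show (2 * k + 1 + 1 + 1) / 2 = k + 1 by omega, show (2 * k + 1 + 1) / 2 = k + 1 by omega,
        show (2 * k + 1) / 2 = k by omega, sum_Ioc_succ_top (Nat.zero_le k), ← add_assoc,
        show 2 * k + 1 + 1 = 2 * (k + 1) by ring]

theorem two_mul_sum_totientSum_div_odd (x : ℕ) :
    2 * ∑ i ∈ range ((x + 1) / 2), totientSum (x / (2 * i + 1)) + x / 2 * (x / 2 + 1)
      = x * (x + 1) := by
  rw [← two_mul_sum_totientSum_div x, sum_Ioc_eq_sum_odd_add_sum_even,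
    ← two_mul_sum_totientSum_div (x / 2), mul_add]
  simp only [Nat.div_div_eq_div_mul]

theorem eight_mul_totientSum_le (x : ℕ) : 8 * totientSum x ≤ 3 * x ^ 2 + 4 * x + 1 := by
  obtain rfl | hx := x.eq_zero_or_pos
  · simp [totientSum]
  have odd_sum := two_mul_sum_totientSum_div_odd x
  have first_le : totientSum x ≤ ∑ i ∈ range ((x + 1) / 2), totientSum (x / (2 * i + 1)) := by
    simpa only [mul_zero, zero_add, Nat.div_one] using
      single_le_sum (f := fun i => totientSum (x / (2 * i + 1))) (fun i _ => Nat.zero_le _)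
        (mem_range.2 (show 0 < (x + 1) / 2 by omega))
  obtain ⟨k, rfl | rfl⟩ := Nat.even_or_odd' x
  · rw [show 2 * k / 2 = k by omega] at odd_sum
    nlinarith
  · rw [show (2 * k + 1) / 2 = k by omega] at odd_sum
    nlinarith

theorem eight_mul_totientSum_div_le (x d : ℕ) :
    8 * (totientSum (x / d) : ℝ) ≤ (3 * x ^ 2 + 16 * x) * (1 / (d : ℝ) ^ 2) + (x / 4 + 1) := by
  have div_le : ((x / d : ℕ) : ℝ) ≤ x * (1 / d) := by
    simpa only [mul_one_div] using Nat.cast_div_le (α := ℝ) (m := x) (n := d)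
  have bound : 8 * (totientSum (x / d) : ℝ)
      ≤ 3 * ((x / d : ℕ) : ℝ) ^ 2 + 4 * ((x / d : ℕ) : ℝ) + 1 :=
    mod_cast eight_mul_totientSum_le (x / d)
  have sq_le : ((x / d : ℕ) : ℝ) ^ 2 ≤ (x * (1 / d)) ^ 2 := by gcongr
  -- AM-GM: `4 x / d ≤ 16 x / d² + x / 4`
  have am_gm : 0 ≤ (x : ℝ) * (8 * (1 / d) - 1) ^ 2 := by positivity
  rw [← one_div_pow]
  linarith

theorem sum_one_div_odd_sq_le (k : ℕ) :
    ∑ i ∈ range k, 1 / ((2 * (i + 1) + 1 : ℕ) : ℝ) ^ 2 ≤ 1 / 4 := by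
  suffices telescoped : ∑ i ∈ range k, 1 / ((2 * (i + 1) + 1 : ℕ) : ℝ) ^ 2
      ≤ 1 / 4 * (1 - 1 / ((k : ℝ) + 1)) by
    have : (0 : ℝ) ≤ 1 / (k + 1) := by positivity
    linarith
  induction k with
  | zero => simp
  | succ k ih =>
    have term_le : 1 / ((2 * (k + 1) + 1 : ℕ) : ℝ) ^ 2
        ≤ 1 / 4 * (1 / (k + 1) - 1 / (k + 1 + 1)) := by
      rw [show (1 : ℝ) / 4 * (1 / (k + 1) - 1 / (k + 1 + 1)) = 1 / (4 * (k + 1) * (k + 2)) by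
        field_simp; ring]
      apply one_div_le_one_div_of_le (by positivity)
      push_cast
      nlinarith
    rw [sum_range_succ]
    push_cast at *
    linarith

theorem sq_le_four_mul_totientSum_of_le {x : ℕ} (hx : 20 ≤ x) : x ^ 2 ≤ 4 * totientSum x := by
  obtain ⟨m, hm⟩ : ∃ m, (x + 1) / 2 = m + 1 := ⟨(x + 1) / 2 - 1, by omega⟩
  have odd_sum : 2 * (∑ i ∈ range m, (totientSum (x / (2 * (i + 1) + 1)) : ℝ) + totientSum x)
      + ((x / 2 : ℕ) : ℝ) * ((x / 2 : ℕ) + 1) = x * (x + 1) := by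
    have h := two_mul_sum_totientSum_div_odd x
    rw [hm, sum_range_succ'] at h
    simp only [mul_zero, zero_add, Nat.div_one] at h
    exact_mod_cast h
  have half_le : ((x / 2 : ℕ) : ℝ) ≤ x / 2 := Nat.cast_div_le
  have m_le : (m : ℝ) ≤ x / 2 := le_trans (mod_cast (by omega : m ≤ x / 2)) half_le
  have tail_le : 8 * ∑ i ∈ range m, (totientSum (x / (2 * (i + 1) + 1)) : ℝ)
      ≤ (3 * x ^ 2 + 16 * x) * (1 / 4) + x / 2 * (x / 4 + 1) := by
    calc 8 * ∑ i ∈ range m, (totientSum (x / (2 * (i + 1) + 1)) : ℝ)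
        ≤ ∑ i ∈ range m, ((3 * (x : ℝ) ^ 2 + 16 * x) * (1 / ((2 * (i + 1) + 1 : ℕ) : ℝ) ^ 2)
            + (x / 4 + 1)) := by
          rw [mul_sum]
          exact sum_le_sum fun i _ => eight_mul_totientSum_div_le x _
      _ = (3 * x ^ 2 + 16 * x) * ∑ i ∈ range m, 1 / ((2 * (i + 1) + 1 : ℕ) : ℝ) ^ 2
            + m * (x / 4 + 1) := by
          rw [sum_add_distrib, ← mul_sum, sum_const, card_range, nsmul_eq_mul]
      _ ≤ _ := by
          gcongr
          exact sum_one_div_odd_sq_le m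
  have half_sq_le : ((x / 2 : ℕ) : ℝ) * ((x / 2 : ℕ) + 1) ≤ x / 2 * (x / 2 + 1) := by gcongr
  have hx' : (20 : ℝ) ≤ x := mod_cast hx
  have real_bound : (x : ℝ) ^ 2 ≤ 4 * totientSum x := by nlinarith
  exact_mod_cast real_bound

theorem sq_le_four_mul_totientSum (x : ℕ) : x ^ 2 ≤ 4 * totientSum x := by
  obtain hx | hx := le_or_gt 20 x
  · exact sq_le_four_mul_totientSum_of_le hx
  · have small : ∀ y < 20, y ^ 2 ≤ 4 * totientSum y := by decide +kernel
    exact small x hx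

/-! ### Enumerating fractions in increasing order -/

/-- A pair `f = (a, b)` stands for the fraction `b / a`, here taken from `[0, 1]`; it is admissible
for `N` if both coordinates of the Pythagorean vector `(a² - b², 2ab)` are below `N`. -/
structure Admissible (N : ℕ) (f : ℕ × ℕ) : Prop where
  pos : 0 < f.1
  sq_lt : f.1 * f.1 < N
  le : f.2 ≤ f.1
  mul_lt : 2 * (f.1 * f.2) < N

/-- The order of fractions `(denominator, numerator)` by cross multiplication, which makes `(0, 1)`
an infinite fraction. -/
def FracLE (f g : ℕ × ℕ) : Prop := f.2 * g.1 ≤ g.2 * f.1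

theorem FracLE.trans {f g h : ℕ × ℕ} (hfg : FracLE f g) (hgh : FracLE g h) (hg : 0 < g.2) :
    FracLE f h := by
  obtain hg0 | hg0 := g.1.eq_zero_or_pos
  · have : h.1 = 0 := by
      simpa only [FracLE, hg0, mul_zero, Nat.le_zero, mul_eq_zero, hg.ne', false_or] using hgh
    simp [FracLE, this]
  · refine Nat.le_of_mul_le_mul_right ?_ hg0
    calc f.2 * h.1 * g.1 = f.2 * g.1 * h.1 := by ring
      _ ≤ g.2 * f.1 * h.1 := Nat.mul_le_mul_right _ hfg
      _ = g.2 * h.1 * f.1 := by ring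
      _ ≤ h.2 * g.1 * f.1 := Nat.mul_le_mul_right _ hgh
      _ = h.2 * f.1 * g.1 := by ring

/-- The numerator of the smallest fraction above `f` with denominator `a`. -/
def numeratorAbove (f : ℕ × ℕ) (a : ℕ) : ℕ := f.2 * a / f.1 + 1

theorem numeratorAbove_le_iff {f : ℕ × ℕ} (hf : 0 < f.1) {a b : ℕ} :
    numeratorAbove f a ≤ b ↔ f.2 * a < b * f.1 := by
  rw [numeratorAbove, Nat.add_one_le_iff, Nat.div_lt_iff_lt_mul hf]

/-- Improve `best` by the smallest fraction above `f` with denominator `a`, if that has numerator at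
most `a` and satisfies the bound of admissibility on `2ab`. -/
def searchStep (N : ℕ) (f best : ℕ × ℕ) (a : ℕ) : ℕ × ℕ :=
  if numeratorAbove f a ≤ a ∧ 2 * (a * numeratorAbove f a) < N ∧
      numeratorAbove f a * best.1 < best.2 * a then (a, numeratorAbove f a) else best

/-- The smallest fraction above `f` found among the denominators at most `k`; the infinite fraction
`(0, 1)` if there is none. -/
def search (N : ℕ) (f : ℕ × ℕ) : ℕ → ℕ × ℕ
  | 0 => (0, 1)
  | k + 1 => searchStep N f (search N f k) (k + 1)

/-- The smallest admissible fraction above `f`. -/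
def next (N : ℕ) (f : ℕ × ℕ) : ℕ × ℕ := search N f (Nat.sqrt (N - 1))

/-- The admissible fractions in increasing order. -/
def enum (N : ℕ) : ℕ → ℕ × ℕ
  | 0 => (1, 0)
  | k + 1 => next N (enum N k)

theorem searchStep_fracLE_best (N : ℕ) (f best : ℕ × ℕ) (a : ℕ) :
    FracLE (searchStep N f best a) best := by
  unfold searchStep
  split_ifs with h
  · exact h.2.2.le
  · exact le_rfl

theorem searchStep_fracLE {N : ℕ} {f : ℕ × ℕ} (best : ℕ × ℕ) {a b : ℕ} (hf : 0 < f.1) (hba : b ≤ a)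
    (hN : 2 * (a * b) < N) (hfb : f.2 * a < b * f.1) : FracLE (searchStep N f best a) (a, b) := by
  have le_b : numeratorAbove f a ≤ b := (numeratorAbove_le_iff hf).2 hfb
  have mul_lt : 2 * (a * numeratorAbove f a) < N := lt_of_le_of_lt (by gcongr) hN
  unfold searchStep
  split_ifs with h
  · exact Nat.mul_le_mul_right a le_b
  · have best_le : best.2 * a ≤ numeratorAbove f a * best.1 :=
      not_lt.1 fun hlt => h ⟨le_b.trans hba, mul_lt, hlt⟩
    exact best_le.trans (Nat.mul_le_mul_right _ le_b)

theorem search_fst_le (N : ℕ) (f : ℕ × ℕ) (k : ℕ) : (search N f k).1 ≤ k := by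
  induction k with
  | zero => rfl
  | succ k ih =>
    simp only [search, searchStep]
    split_ifs
    · exact le_rfl
    · exact ih.trans k.le_succ

theorem search_snd_pos (N : ℕ) (f : ℕ × ℕ) (k : ℕ) : 0 < (search N f k).2 := by
  induction k with
  | zero => exact one_pos
  | succ k ih =>
    simp only [search, searchStep]
    split_ifs
    · exact Nat.succ_pos _
    · exact ih

theorem search_snd_le (N : ℕ) (f : ℕ × ℕ) (k : ℕ) : (search N f k).2 ≤ (search N f k).1 + 1 := by
  induction k with
  | zero => rfl
  | succ k ih =>
    simp only [search, searchStep]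
    split_ifs with h
    · exact h.1.trans (Nat.le_succ _)
    · exact ih

theorem search_eq_or_admissible {N k : ℕ} {f : ℕ × ℕ} (hf : 0 < f.1) (hk : k ≤ Nat.sqrt (N - 1)) :
    search N f k = (0, 1) ∨
      Admissible N (search N f k) ∧ f.2 * (search N f k).1 < (search N f k).2 * f.1 := by
  induction k with
  | zero => exact Or.inl rfl
  | succ k ih =>
    simp only [search, searchStep]
    split_ifs with h
    · have sq_le : (k + 1) * (k + 1) ≤ N - 1 := Nat.le_sqrt.1 hk
      have : 0 < (k + 1) * (k + 1) := by positivity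
      exact Or.inr ⟨⟨k.succ_pos, (by omega : (k + 1) * (k + 1) < N), h.1, h.2.1⟩,
        (numeratorAbove_le_iff hf).1 le_rfl⟩
    · exact ih (k.le_succ.trans hk)

theorem search_fracLE {N k : ℕ} {f g : ℕ × ℕ} (hf : 0 < f.1) (hg : Admissible N g) (hgk : g.1 ≤ k)
    (hfg : f.2 * g.1 < g.2 * f.1) : FracLE (search N f k) g := by
  induction k with
  | zero => exact absurd hg.pos hgk.not_gt
  | succ k ih =>
    obtain hgk' | hgk' := hgk.lt_or_eq
    · exact (searchStep_fracLE_best N f _ _).trans (ih (Nat.lt_succ_iff.1 hgk'))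
        (search_snd_pos N f k)
    · rw [search, ← hgk']
      exact searchStep_fracLE _ hf hg.le hg.mul_lt hfg

theorem Admissible.fst_le_sqrt {N : ℕ} {f : ℕ × ℕ} (hf : Admissible N f) :
    f.1 ≤ Nat.sqrt (N - 1) := by
  have := hf.sq_lt
  exact Nat.le_sqrt.2 (by omega)

/-- The rational number that a fraction stands for. -/
def value (f : ℕ × ℕ) : ℚ := f.2 / f.1

theorem value_lt_value {f g : ℕ × ℕ} (hf : 0 < f.1) (hg : 0 < g.1) :
    value f < value g ↔ f.2 * g.1 < g.2 * f.1 := by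
  rw [value, value, div_lt_div_iff₀ (mod_cast hf) (mod_cast hg)]
  norm_cast

theorem value_le_value {f g : ℕ × ℕ} (hf : 0 < f.1) (hg : 0 < g.1) :
    value f ≤ value g ↔ FracLE f g := by
  rw [value, value, div_le_div_iff₀ (mod_cast hf) (mod_cast hg), FracLE]
  norm_cast

open Classical in
/-- The values of the admissible fractions. -/
noncomputable def values (N : ℕ) : Finset ℚ :=
  ((range N ×ˢ range N).filter (Admissible N)).image value

theorem mem_values {N : ℕ} {q : ℚ} : q ∈ values N ↔ ∃ f, Admissible N f ∧ value f = q := by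
  simp only [values, mem_image, mem_filter, mem_product, mem_range]
  refine exists_congr fun f => and_congr_left fun _ => and_iff_right_of_imp fun hf => ?_
  have fst_lt : f.1 < N := f.1.le_mul_self.trans_lt hf.sq_lt
  exact ⟨fst_lt, hf.le.trans_lt fst_lt⟩

theorem next_spec {N : ℕ} {f : ℕ × ℕ} (hf : 0 < f.1) (hex : ∃ q ∈ values N, value f < q) :
    Admissible N (next N f) ∧ value f < value (next N f) ∧
      ∀ q ∈ values N, value f < q → value (next N f) ≤ q := by
  have next_fracLE {g : ℕ × ℕ} (hg : Admissible N g) (hfg : value f < value g) :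
      FracLE (next N f) g :=
    search_fracLE hf hg hg.fst_le_sqrt ((value_lt_value hf hg.pos).1 hfg)
  obtain next_eq | ⟨hnext, hlt⟩ := search_eq_or_admissible hf (le_refl (Nat.sqrt (N - 1)))
  · obtain ⟨q, hq, hfq⟩ := hex
    obtain ⟨g, hg, rfl⟩ := mem_values.1 hq
    have g_le_zero : g.1 ≤ 0 := by
      simpa only [FracLE, next, next_eq, one_mul, mul_zero] using next_fracLE hg hfq
    exact absurd hg.pos g_le_zero.not_gt
  · refine ⟨hnext, (value_lt_value hf hnext.pos).2 hlt, fun q hq hfq => ?_⟩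
    obtain ⟨g, hg, rfl⟩ := mem_values.1 hq
    exact (value_le_value hnext.pos hg.pos).2 (next_fracLE hg hfq)

theorem card_filter_gt_le_succ {α : Type*} [LinearOrder α] (s : Finset α) {x y : α}
    (h : ∀ z ∈ s, x < z → y ≤ z) : #{z ∈ s | x < z} ≤ #{z ∈ s | y < z} + 1 := by
  refine (card_le_card fun z hz => ?_).trans (card_insert_le y _)
  rw [mem_filter] at hz
  rw [mem_insert, mem_filter]
  exact (h z hz.1 hz.2).eq_or_lt.imp Eq.symm fun hlt => ⟨hz.1, hlt⟩

theorem enum_spec {N k : ℕ} (hk : k < #(values N)) :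
    Admissible N (enum N k) ∧ #(values N) ≤ #{q ∈ values N | value (enum N k) < q} + (k + 1) := by
  induction k with
  | zero =>
    obtain ⟨q, hq⟩ := card_pos.1 hk
    obtain ⟨f, hf, -⟩ := mem_values.1 hq
    have one_lt : 1 < N := lt_of_le_of_lt (Nat.mul_pos hf.pos hf.pos) hf.sq_lt
    refine ⟨⟨one_pos, one_lt, Nat.zero_le 1, one_pos.trans one_lt⟩, ?_⟩
    have value_zero : value (enum N 0) = 0 := by simp [enum, value]
    have nonneg : ∀ q ∈ values N, 0 ≤ q := fun q hq => by
      obtain ⟨f, -, rfl⟩ := mem_values.1 hq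
      exact div_nonneg (Nat.cast_nonneg _) (Nat.cast_nonneg _)
    calc #(values N) = #{q ∈ values N | -1 < q} := by
          rw [filter_true_of_mem fun q hq => neg_one_lt_zero.trans_le (nonneg q hq)]
      _ ≤ _ := card_filter_gt_le_succ _ fun q hq _ => value_zero.trans_le (nonneg q hq)
  | succ k ih =>
    obtain ⟨hadm, hcard⟩ := ih (by omega)
    obtain ⟨q, hq⟩ := card_pos.1 (show 0 < #{q ∈ values N | value (enum N k) < q} by omega)
    obtain ⟨next_adm, -, next_le⟩ := next_spec hadm.pos ⟨q, mem_filter.1 hq⟩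
    refine ⟨next_adm, ?_⟩
    have := card_filter_gt_le_succ (values N) next_le
    change _ ≤ #{q ∈ values N | value (next N (enum N k)) < q} + _
    omega

theorem enum_strictMonoOn (N : ℕ) :
    StrictMonoOn (fun k => value (enum N k)) (Set.Iio #(values N)) := by
  refine strictMonoOn_of_lt_add_one Set.ordConnected_Iio fun k _ _ hk => ?_
  have hk : k + 1 < #(values N) := hk
  obtain ⟨hadm, hcard⟩ := enum_spec (show k < #(values N) by omega)
  obtain ⟨q, hq⟩ := card_pos.1 (show 0 < #{q ∈ values N | value (enum N k) < q} by omega)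
  exact (next_spec hadm.pos ⟨q, mem_filter.1 hq⟩).2.1

theorem enum_fst_le (N k : ℕ) : (enum N k).1 ≤ N + 1 := by
  cases k with
  | zero => exact Nat.le_add_left 1 N
  | succ k => exact (search_fst_le N _ _).trans ((Nat.sqrt_le_self _).trans (by omega))

theorem enum_snd_le (N k : ℕ) : (enum N k).2 ≤ N + 1 := by
  cases k with
  | zero => exact Nat.zero_le _
  | succ k =>
    have fst_le : (enum N (k + 1)).1 ≤ N :=
      (search_fst_le N _ _).trans ((Nat.sqrt_le_self _).trans N.pred_le)
    exact (search_snd_le N _ _).trans (Nat.succ_le_succ fst_le)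

/-! ### There are enough admissible fractions -/

theorem totient_le_two_mul_card (a : ℕ) :
    Nat.totient a ≤ 2 * #{b ∈ range a | a.Coprime b ∧ 2 * b ≤ a} := by
  have split : Nat.totient a = #{b ∈ range a | a.Coprime b ∧ 2 * b ≤ a}
      + #{b ∈ range a | a.Coprime b ∧ ¬ 2 * b ≤ a} := by
    rw [Nat.totient_eq_card_coprime, ← filter_filter, ← filter_filter,
      card_filter_add_card_filter_not]
  have reflect : #{b ∈ range a | a.Coprime b ∧ ¬ 2 * b ≤ a}
      ≤ #{b ∈ range a | a.Coprime b ∧ 2 * b ≤ a} := by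
    refine card_le_card_of_injOn (fun b => a - b) (fun b hb => ?_) fun b hb c hc h => ?_
    · simp only [coe_filter, mem_range, Set.mem_ofPred_eq] at hb ⊢
      exact ⟨by omega, (Nat.coprime_self_sub_right hb.1.le).2 hb.2.1, by omega⟩
    · simp only [coe_filter, mem_range, Set.mem_ofPred_eq] at hb hc h
      omega
  omega

theorem eq_of_value_eq {f g : ℕ × ℕ} (hf : 0 < f.1) (hg : 0 < g.1) (hf' : f.1.Coprime f.2)
    (hg' : g.1.Coprime g.2) (h : value f = value g) : f = g := by
  obtain ⟨snd_eq, fst_eq⟩ := Rat.div_int_inj (a := f.2) (b := f.1) (c := g.2) (d := g.1)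
    (mod_cast hf) (mod_cast hg) hf'.symm hg'.symm (by simpa only [value, Int.cast_natCast] using h)
  exact Prod.ext (mod_cast fst_eq) (mod_cast snd_eq)

/-- Pairs of coprime numbers `b < a ≤ m` with `a ≤ k` or `2b ≤ a`: they satisfy `a² ≤ m²` and
`2ab ≤ max (2k²) m²`. -/
def coprimePairs (m k : ℕ) : Finset ((_ : ℕ) × ℕ) :=
  (Ioc 0 m).sigma fun a => {b ∈ range a | a.Coprime b ∧ (a ≤ k ∨ 2 * b ≤ a)}

theorem mem_coprimePairs {m k a b : ℕ} :
    ⟨a, b⟩ ∈ coprimePairs m k ↔ a ≤ m ∧ b < a ∧ a.Coprime b ∧ (a ≤ k ∨ 2 * b ≤ a) := by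
  simp only [coprimePairs, mem_sigma, mem_Ioc, mem_filter, mem_range]
  omega

theorem totientSum_add_totientSum_le {m k : ℕ} (hkm : k ≤ m) :
    totientSum m + totientSum k ≤ 2 * #(coprimePairs m k) := by
  have totientSum_k : totientSum k = ∑ a ∈ Ioc 0 m, if a ≤ k then Nat.totient a else 0 := by
    rw [← sum_filter, totientSum]
    congr 1
    ext a
    simp only [mem_Ioc, mem_filter]
    omega
  rw [coprimePairs, card_sigma, mul_sum, totientSum_k, totientSum, ← sum_add_distrib]
  refine sum_le_sum fun a _ => ?_
  split_ifs with h
  · simp [h, Nat.totient_eq_card_coprime, two_mul]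
  · simpa [h] using totient_le_two_mul_card a

theorem card_coprimePairs_le {N m k : ℕ} (hm : m * m < N) (hk : 2 * (k * k) < N) :
    #(coprimePairs m k) ≤ #(values N) := by
  refine card_le_card_of_injOn (fun p => value (p.1, p.2)) ?_ ?_
  · rintro ⟨a, b⟩ hab
    obtain ⟨ham, hba, -, h⟩ := mem_coprimePairs.1 hab
    refine mem_coe.2 (mem_values.2 ⟨(a, b), ⟨hba.pos, ?_, hba.le, ?_⟩, rfl⟩)
    · exact (Nat.mul_le_mul ham ham).trans_lt hm
    · obtain hak | h2b := h
      · exact lt_of_le_of_lt (by gcongr; omega) hk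
      · calc 2 * (a * b) = a * (2 * b) := by ring
          _ ≤ m * m := by gcongr; omega
          _ < N := hm
  · rintro ⟨a, b⟩ hab ⟨c, d⟩ hcd h
    obtain ⟨-, hba, hab', -⟩ := mem_coprimePairs.1 hab
    obtain ⟨-, hdc, hcd', -⟩ := mem_coprimePairs.1 hcd
    cases eq_of_value_eq hba.pos hdc.pos hab' hcd' h
    rfl

theorem eight_mul_le_sqrt_sq_add_sqrt_sq {t : ℕ} (ht : 40 ≤ t) :
    8 * t ≤ Nat.sqrt (13 * t / 2 - 1) ^ 2 + Nat.sqrt ((13 * t / 2 - 1) / 2) ^ 2 := by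
  have m_sq := Nat.sqrt_le (13 * t / 2 - 1)
  have k_sq := Nat.sqrt_le ((13 * t / 2 - 1) / 2)
  have lt_m_sq := Nat.lt_succ_sqrt (13 * t / 2 - 1)
  have lt_k_sq := Nat.lt_succ_sqrt ((13 * t / 2 - 1) / 2)
  generalize Nat.sqrt (13 * t / 2 - 1) = m at *
  generalize Nat.sqrt ((13 * t / 2 - 1) / 2) = k at *
  rw [Nat.succ_eq_add_one] at lt_m_sq lt_k_sq
  have m_lower : 13 * t ≤ 2 * ((m + 1) * (m + 1)) + 1 := by omega
  have k_lower : 13 * t ≤ 4 * ((k + 1) * (k + 1)) + 1 := by omega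
  have m_upper : 2 * (m * m) ≤ 13 * t := by omega
  have k_upper : 4 * (k * k) ≤ 13 * t := by omega
  zify at *
  nlinarith [sq_nonneg ((m : ℤ) - 16), sq_nonneg ((k : ℤ) - 11)]

theorem le_card_values {t : ℕ} (ht : 0 < t) : t ≤ #(values (13 * t / 2)) := by
  have m_sq := Nat.sqrt_le (13 * t / 2 - 1)
  have k_sq := Nat.sqrt_le ((13 * t / 2 - 1) / 2)
  have pairs_le := card_coprimePairs_le (N := 13 * t / 2) (by omega) (by omega)
    (m := Nat.sqrt (13 * t / 2 - 1)) (k := Nat.sqrt ((13 * t / 2 - 1) / 2))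
  have sum_le := totientSum_add_totientSum_le
    (m := Nat.sqrt (13 * t / 2 - 1)) (k := Nat.sqrt ((13 * t / 2 - 1) / 2))
    (Nat.sqrt_le_sqrt (Nat.div_le_self _ 2))
  suffices enough : 2 * t ≤
      totientSum (Nat.sqrt (13 * t / 2 - 1)) + totientSum (Nat.sqrt ((13 * t / 2 - 1) / 2)) by omega
  obtain ht40 | ht40 := Nat.lt_or_ge t 40
  · have small : ∀ t < 40, 2 * t ≤ totientSum (Nat.sqrt (13 * t / 2 - 1))
        + totientSum (Nat.sqrt ((13 * t / 2 - 1) / 2)) := by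
      decide +kernel
    exact small t ht40
  · have := eight_mul_le_sqrt_sq_add_sqrt_sq ht40
    have := sq_le_four_mul_totientSum (Nat.sqrt (13 * t / 2 - 1))
    have := sq_le_four_mul_totientSum (Nat.sqrt ((13 * t / 2 - 1) / 2))
    omega

end Fractions

/-! ### Ancestors in rooted trees -/

namespace Drawing

open RootedTree

variable {V : Type u} {G : SimpleGraph V} {r : V}

theorem isChild_or_isChild_of_adj (hG : G.IsTree) (r : V) {u v : V} (h : G.Adj u v) :
    IsChild G r u v ∨ IsChild G r v u :=
  (hG.dist_eq_dist_add_one_of_adj r h).symm.imp (⟨h, ·⟩) (⟨h.symm, ·⟩)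

theorem isChild_unique (hG : G.IsTree) {p q c : V} (hp : IsChild G r p c)
    (hq : IsChild G r q c) : p = q := by
  have notMem_support {p : V} (hp : IsChild G r p c) (W : G.Walk r p)
      (hW : W.length = G.dist r p) : c ∉ W.support := by
    intro hc
    classical
    have := SimpleGraph.dist_le (W.takeUntil c hc)
    have := W.length_takeUntil_le_length hc
    have := hp.2
    omega
  obtain ⟨P, hP, hPl⟩ := hG.connected.exists_path_of_dist r p
  obtain ⟨Q, hQ, hQl⟩ := hG.connected.exists_path_of_dist r q
  have concat_eq : P.concat hp.1 = Q.concat hq.1 :=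
    (hG.existsUnique_path r c).unique (hP.concat (notMem_support hp P hPl) hp.1)
      (hQ.concat (notMem_support hq Q hQl) hq.1)
  simpa using congrArg SimpleGraph.Walk.penultimate concat_eq

theorem exists_isChild (hG : G.IsTree) {c : V} (hc : c ≠ r) : ∃ p, IsChild G r p c := by
  obtain ⟨P, -, hPl⟩ := hG.connected.exists_path_of_dist r c
  have not_nil : ¬ P.Nil := SimpleGraph.Walk.not_nil_of_ne hc.symm
  have dist_le := SimpleGraph.dist_le P.dropLast
  have length_eq := SimpleGraph.Walk.length_dropLast_add_one not_nil
  refine ⟨P.penultimate, P.adj_penultimate not_nil, ?_⟩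
  have := hG.dist_eq_dist_add_one_of_adj r (P.adj_penultimate not_nil)
  omega

theorem not_isChild_root (p : V) : ¬ IsChild G r p r := fun h => by
  simpa using h.2

/-- The ancestor relation of the rooted tree, in which every vertex is an ancestor of itself. -/
abbrev IsAncestor (G : SimpleGraph V) (r : V) : V → V → Prop :=
  Relation.ReflTransGen (IsChild G r)

theorem isAncestor_root (hG : G.IsTree) (v : V) : IsAncestor G r r v := by
  induction h : G.dist r v generalizing v with
  | zero => exact (hG.connected.dist_eq_zero_iff.1 h) ▸ .refl
  | succ k ih =>
    have v_ne : v ≠ r := by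
      rintro rfl
      simp at h
    obtain ⟨p, hp⟩ := exists_isChild hG v_ne
    exact (ih p (by have := hp.2; omega)).tail hp

theorem isAncestor_trichotomy (hG : G.IsTree) (r u v : V) :
    IsAncestor G r u v ∨ IsAncestor G r v u ∨
      ∃ q e e', IsChild G r q e ∧ IsChild G r q e' ∧ e ≠ e' ∧
        IsAncestor G r e u ∧ IsAncestor G r e' v := by
  induction isAncestor_root (r := r) hG u with
  | refl => exact Or.inl (isAncestor_root hG v)
  | @tail u c _ hc ih =>
    obtain h | h | ⟨q, e, e', he, he', hne, heu, hev⟩ := ih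
    · obtain rfl | ⟨e', he', hev⟩ := h.cases_head
      · exact Or.inr (Or.inl (.single hc))
      · by_cases hce : c = e'
        · exact Or.inl (hce ▸ hev)
        · exact Or.inr (Or.inr ⟨u, c, e', hc, he', hce, .refl, hev⟩)
    · exact Or.inr (Or.inl (h.tail hc))
    · exact Or.inr (Or.inr ⟨q, e, e', he, he', hne, heu.tail hc, hev⟩)

theorem eq_or_isAncestor_of_isChild (hG : G.IsTree) {e p c : V} (h : IsAncestor G r e c)
    (hp : IsChild G r p c) : e = c ∨ IsAncestor G r e p := by
  obtain rfl | ⟨p', hep', hp'⟩ := h.cases_tail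
  · exact Or.inl rfl
  · exact Or.inr (isChild_unique hG hp hp' ▸ hep')

/-! ### Drawing siblings in separated cones -/

section Layout

variable {E : Type*} [AddCommGroup E] [Module ℝ E] {B : LinearMap.BilinForm ℝ E}
  {height : Module.Dual ℝ E} {P : V → E} {S : V → Set E}

theorem eq_zero_or_pos_of_mem_hull (f : Module.Dual ℝ E) {s : Set E} (hf : ∀ x ∈ s, 0 < f x)
    {x : E} (hx : x ∈ PointedCone.hull ℝ s) : x = 0 ∨ 0 < f x := by
  induction hx using Submodule.span_induction with
  | mem x hx => exact Or.inr (hf x hx)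
  | zero => exact Or.inl rfl
  | add x y _ _ hx hy =>
    obtain rfl | hx := hx
    · rwa [zero_add]
    obtain rfl | hy := hy
    · rw [add_zero]
      exact Or.inr hx
    · rw [map_add]
      exact Or.inr (add_pos hx hy)
  | smul a x _ hx =>
    obtain rfl | ha := eq_or_ne a 0
    · exact Or.inl (zero_smul _ x)
    · refine hx.imp (fun h => by rw [h, smul_zero]) fun h => ?_
      change 0 < f ((a : ℝ) • x)
      rw [map_smul]
      exact smul_pos (NNReal.coe_pos.2 (pos_iff_ne_zero.2 ha)) h

theorem eq_zero_of_mem_hull_of_mem_hull (hB : B.IsAlt) {s t : Set E}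
    (hst : ∀ x ∈ s, ∀ y ∈ t, 0 < B x y) {x : E} (hs : x ∈ PointedCone.hull ℝ s)
    (ht : x ∈ PointedCone.hull ℝ t) : x = 0 := by
  by_contra hx
  have pos_of_mem : ∀ y ∈ t, 0 < B x y := fun y hy =>
    (eq_zero_or_pos_of_mem_hull (B.flip y) (fun z hz => hst z hz y hy) hs).resolve_left hx
  have self_pos : 0 < B x x := (eq_zero_or_pos_of_mem_hull (B x) pos_of_mem ht).resolve_left hx
  exact self_pos.ne' (hB x)

/-- A placement `P` of the vertices such that the edge from the parent of `v` to `v` has a direction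
in `S v`, the directions of a vertex are among those of its parent, all directions point upwards as
measured by `height`, and the alternating form `B` separates the directions of siblings. -/
structure IsLayout (G : SimpleGraph V) (r : V) (B : LinearMap.BilinForm ℝ E)
    (height : Module.Dual ℝ E) (P : V → E) (S : V → Set E) : Prop where
  vector_mem : ∀ ⦃p c⦄, IsChild G r p c → P c - P p ∈ S c
  subset : ∀ ⦃p c⦄, IsChild G r p c → S c ⊆ S p
  height_pos : ∀ v, ∀ x ∈ S v, 0 < height x
  separated : ∀ ⦃q c c'⦄, IsChild G r q c → IsChild G r q c' → c ≠ c' →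
    (∀ x ∈ S c, ∀ y ∈ S c', 0 < B x y) ∨ (∀ x ∈ S c, ∀ y ∈ S c', 0 < B y x)

namespace IsLayout

theorem subset_of_isAncestor (h : IsLayout G r B height P S) {u v : V}
    (huv : IsAncestor G r u v) : S v ⊆ S u := by
  induction huv with
  | refl => exact subset_rfl
  | tail _ hc ih => exact (h.subset hc).trans ih

theorem sub_mem_hull (h : IsLayout G r B height P S) {u v : V} (huv : IsAncestor G r u v) :
    P v - P u ∈ PointedCone.hull ℝ (S u) := by
  induction huv with
  | refl => rw [sub_self]; exact zero_mem _
  | tail hup hc ih =>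
    rw [← sub_add_sub_cancel]
    exact add_mem (PointedCone.subset_hull
      (h.subset_of_isAncestor (hup.tail hc) (h.vector_mem hc))) ih

theorem sub_mem_hull_of_mem_segment (h : IsLayout G r B height P S) (hG : G.IsTree) {q e p c : V}
    (he : IsChild G r q e) (hec : IsAncestor G r e c) (hc : IsChild G r p c) {x : E}
    (hx : x ∈ segment ℝ (P p) (P c)) : x - P q ∈ PointedCone.hull ℝ (S e) := by
  have start_mem : P p - P q ∈ PointedCone.hull ℝ (S e) := by
    obtain rfl | hep := eq_or_isAncestor_of_isChild hG hec hc
    · rw [isChild_unique hG hc he, sub_self]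
      exact zero_mem _
    · rw [← sub_add_sub_cancel]
      exact add_mem (h.sub_mem_hull hep) (PointedCone.subset_hull (h.vector_mem he))
  rw [segment_eq_image'] at hx
  obtain ⟨a, ⟨ha, -⟩, rfl⟩ := hx
  rw [add_sub_right_comm]
  exact add_mem start_mem (Submodule.smul_mem _ (⟨a, ha⟩ : {a : ℝ // 0 ≤ a})
    (PointedCone.subset_hull (h.subset_of_isAncestor hec (h.vector_mem hc))))

theorem sub_mem_hull_of_isChild (h : IsLayout G r B height P S) (hG : G.IsTree) {q e v : V}
    (he : IsChild G r q e) (hev : IsAncestor G r e v) :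
    P v - P q ∈ PointedCone.hull ℝ (S e) := by
  obtain rfl | ⟨p, -, hp⟩ := hev.cases_tail
  · exact PointedCone.subset_hull (h.vector_mem he)
  · exact h.sub_mem_hull_of_mem_segment hG he hev hp (right_mem_segment ℝ _ _)

theorem eq_of_sub_mem_hull_of_sub_mem_hull (h : IsLayout G r B height P S) (hB : B.IsAlt)
    {q e e' : V} (he : IsChild G r q e) (he' : IsChild G r q e') (hne : e ≠ e') {x : E}
    (hx : x - P q ∈ PointedCone.hull ℝ (S e)) (hx' : x - P q ∈ PointedCone.hull ℝ (S e')) :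
    x = P q := by
  rw [← sub_eq_zero]
  obtain hsep | hsep := h.separated he he' hne
  · exact eq_zero_of_mem_hull_of_mem_hull hB hsep hx hx'
  · exact eq_zero_of_mem_hull_of_mem_hull hB (fun y hy z hz => hsep z hz y hy) hx' hx

theorem height_lt_of_isChild (h : IsLayout G r B height P S) {p c : V} (hc : IsChild G r p c) :
    height (P p) < height (P c) := by
  simpa only [map_sub, sub_pos] using h.height_pos c _ (h.vector_mem hc)

theorem eq_or_height_lt (h : IsLayout G r B height P S) {u v : V} (huv : IsAncestor G r u v) :
    u = v ∨ height (P u) < height (P v) := by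
  induction huv with
  | refl => exact Or.inl rfl
  | tail _ hc ih =>
    obtain rfl | ih := ih
    · exact Or.inr (h.height_lt_of_isChild hc)
    · exact Or.inr (ih.trans (h.height_lt_of_isChild hc))

theorem height_le (h : IsLayout G r B height P S) {u v : V} (huv : IsAncestor G r u v) :
    height (P u) ≤ height (P v) := by
  obtain rfl | huv := h.eq_or_height_lt huv
  exacts [le_rfl, huv.le]

theorem ne_of_isChild_of_isAncestor (h : IsLayout G r B height P S) {q e v : V}
    (he : IsChild G r q e) (hev : IsAncestor G r e v) : P v ≠ P q := fun heq =>
  ((h.height_lt_of_isChild he).trans_le (h.height_le hev)).ne (congrArg height heq).symm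

theorem height_mem_Icc_of_mem_segment (h : IsLayout G r B height P S) {p c : V}
    (hc : IsChild G r p c) {x : E} (hx : x ∈ segment ℝ (P p) (P c)) :
    height x ∈ Set.Icc (height (P p)) (height (P c)) := by
  rw [← segment_eq_Icc (h.height_lt_of_isChild hc).le, ← LinearMap.coe_toAffineMap,
    ← image_segment]
  exact Set.mem_image_of_mem _ hx

theorem eq_right_of_height_le (h : IsLayout G r B height P S) {p c : V} (hc : IsChild G r p c)
    {x : E} (hx : x ∈ segment ℝ (P p) (P c)) (hle : height (P c) ≤ height x) : x = P c := by
  rw [segment_eq_image'] at hx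
  obtain ⟨a, ⟨-, ha⟩, rfl⟩ := hx
  have := h.height_lt_of_isChild hc
  simp only [map_add, map_smul, map_sub, smul_eq_mul] at hle
  obtain rfl : a = 1 := by nlinarith
  exact (congrArg _ (one_smul ℝ _)).trans (add_sub_cancel _ _)

theorem injective (h : IsLayout G r B height P S) (hG : G.IsTree) (hB : B.IsAlt) :
    Function.Injective P := by
  intro u v huv
  obtain hanc | hanc | ⟨q, e, e', he, he', hne, heu, hev⟩ := isAncestor_trichotomy hG r u v
  · exact (h.eq_or_height_lt hanc).resolve_right (congrArg height huv).not_lt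
  · exact ((h.eq_or_height_lt hanc).resolve_right (congrArg height huv).not_gt).symm
  · exact absurd (h.eq_of_sub_mem_hull_of_sub_mem_hull hB he he' hne
      (h.sub_mem_hull_of_isChild hG he heu) (huv ▸ h.sub_mem_hull_of_isChild hG he' hev))
      (h.ne_of_isChild_of_isAncestor he heu)

theorem eq_or_eq_of_mem_segment (h : IsLayout G r B height P S) (hG : G.IsTree) (hB : B.IsAlt)
    {p c w : V} (hc : IsChild G r p c) (hw : P w ∈ segment ℝ (P p) (P c)) : w = p ∨ w = c := by
  have ⟨le_height, height_le⟩ := h.height_mem_Icc_of_mem_segment hc hw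
  obtain hcw | hwc | ⟨q, e, e', he, he', hne, hec, hew⟩ := isAncestor_trichotomy hG r c w
  · exact Or.inr ((h.eq_or_height_lt hcw).resolve_right height_le.not_gt).symm
  · obtain rfl | hwp := eq_or_isAncestor_of_isChild hG hwc hc
    · exact Or.inr rfl
    · exact Or.inl ((h.eq_or_height_lt hwp).resolve_right le_height.not_gt)
  · exact absurd (h.eq_of_sub_mem_hull_of_sub_mem_hull hB he he' hne
      (h.sub_mem_hull_of_mem_segment hG he hec hc hw) (h.sub_mem_hull_of_isChild hG he' hew))
      (h.ne_of_isChild_of_isAncestor he' hew)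

theorem eq_right_of_isAncestor (h : IsLayout G r B height P S) {p c q d : V}
    (hc : IsChild G r p c) (hd : IsChild G r q d) (hcq : IsAncestor G r c q) {x : E}
    (hx : x ∈ segment ℝ (P p) (P c)) (hx' : x ∈ segment ℝ (P q) (P d)) : x = P c :=
  h.eq_right_of_height_le hc hx
    ((h.height_le hcq).trans (h.height_mem_Icc_of_mem_segment hd hx').1)

theorem exists_common_endpoint (h : IsLayout G r B height P S) (hG : G.IsTree) (hB : B.IsAlt)
    {p c q d : V} (hc : IsChild G r p c) (hd : IsChild G r q d) (hne : c ≠ d) {x : E}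
    (hx : x ∈ segment ℝ (P p) (P c)) (hx' : x ∈ segment ℝ (P q) (P d)) :
    ∃ z, (z = p ∨ z = c) ∧ (z = q ∨ z = d) ∧ x = P z := by
  suffices ∃ z, x = P z by
    obtain ⟨z, rfl⟩ := this
    exact ⟨z, h.eq_or_eq_of_mem_segment hG hB hc hx, h.eq_or_eq_of_mem_segment hG hB hd hx', rfl⟩
  obtain hcd | hdc | ⟨o, e, e', he, he', hne', hec, hed⟩ := isAncestor_trichotomy hG r c d
  · exact ⟨c, h.eq_right_of_isAncestor hc hd
      ((eq_or_isAncestor_of_isChild hG hcd hd).resolve_left hne) hx hx'⟩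
  · exact ⟨d, h.eq_right_of_isAncestor hd hc
      ((eq_or_isAncestor_of_isChild hG hdc hc).resolve_left hne.symm) hx' hx⟩
  · exact ⟨o, h.eq_of_sub_mem_hull_of_sub_mem_hull hB he he' hne'
      (h.sub_mem_hull_of_mem_segment hG he hec hc hx)
      (h.sub_mem_hull_of_mem_segment hG he' hed hd hx')⟩

end IsLayout

end Layout

theorem IsLayout.isFary {B : LinearMap.BilinForm ℝ (EuclideanSpace ℝ (Fin 2))}
    {height : Module.Dual ℝ (EuclideanSpace ℝ (Fin 2))} {P : V → EuclideanSpace ℝ (Fin 2)}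
    {S : V → Set (EuclideanSpace ℝ (Fin 2))} (h : IsLayout G r B height P S) (hG : G.IsTree)
    (hB : B.IsAlt) : IsFary G P where
  injective := h.injective hG hB
  vertex_edge u v w huv hw := by
    obtain huv | hvu := isChild_or_isChild_of_adj hG r huv
    · exact h.eq_or_eq_of_mem_segment hG hB huv hw
    · exact (h.eq_or_eq_of_mem_segment hG hB hvu (segment_symm ℝ (P u) (P v) ▸ hw)).symm
  edge_edge u v w x huv hwx hne y hy := by
    wlog huv' : IsChild G r u v generalizing u v
    · obtain ⟨z, hz, hz', rfl⟩ := this v u huv.symm (by rwa [Sym2.eq_swap])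
        (by rwa [segment_symm]) ((isChild_or_isChild_of_adj hG r huv).resolve_left huv')
      exact ⟨z, hz.symm, hz', rfl⟩
    wlog hwx' : IsChild G r w x generalizing w x
    · obtain ⟨z, hz, hz', rfl⟩ := this x w hwx.symm (by rwa [Sym2.eq_swap (a := x)])
        (by rwa [segment_symm ℝ (P x)]) ((isChild_or_isChild_of_adj hG r hwx).resolve_left hwx')
      exact ⟨z, hz, hz'.symm, rfl⟩
    refine h.exists_common_endpoint hG hB huv' hwx' ?_ hy.1 hy.2
    rintro rfl
    exact hne (by rw [isChild_unique hG huv' hwx'])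

end Drawing

/-! ### The layout given by a preorder traversal -/

namespace Drawing

open RootedTree Finset

variable {V : Type u} {G : SimpleGraph V} {r : V}

theorem dist_le_of_isAncestor {u v : V} (h : IsAncestor G r u v) : G.dist r u ≤ G.dist r v := by
  induction h with
  | refl => exact le_rfl
  | tail _ hc ih => exact ih.trans (hc.2 ▸ Nat.le_succ _)

theorem not_isAncestor_of_isChild {p c : V} (h : IsChild G r p c) : ¬ IsAncestor G r c p :=
  fun h' => (dist_le_of_isAncestor h').not_gt (h.2 ▸ Nat.lt_succ_self _)

theorem eq_root_of_isAncestor_root {u : V} (h : IsAncestor G r u r) : u = r := by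
  obtain h | ⟨p, -, hp⟩ := h.cases_tail
  · exact h.symm
  · exact absurd hp (not_isChild_root p)

theorem sibling_eq_of_isAncestor (hG : G.IsTree) {q e e' u : V} (he : IsChild G r q e)
    (he' : IsChild G r q e') (h : IsAncestor G r e u) (h' : IsAncestor G r e' u) : e = e' := by
  have eq_of_isAncestor {e e' : V} (he : IsChild G r q e) (he' : IsChild G r q e')
      (h : IsAncestor G r e e') : e = e' :=
    (eq_or_isAncestor_of_isChild hG h he').resolve_right (not_isAncestor_of_isChild he)
  have total : IsAncestor G r e e' ∨ IsAncestor G r e' e := by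
    rw [IsAncestor, ← Relation.reflTransGen_swap, ← Relation.reflTransGen_swap (r := IsChild G r)]
    exact Relation.ReflTransGen.total_of_right_unique (fun _ _ _ hp hq => isChild_unique hG hp hq)
      (Relation.reflTransGen_swap.2 h') (Relation.reflTransGen_swap.2 h)
  exact total.elim (eq_of_isAncestor he he') fun h => (eq_of_isAncestor he' he h).symm

theorem dist_lt_card [Fintype V] (hG : G.IsTree) (v : V) : G.dist r v < Fintype.card V := by
  obtain ⟨P, hP, hPl⟩ := hG.connected.exists_path_of_dist r v
  exact hPl ▸ hP.length_lt

open Classical in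
/-- The parent of a vertex; the root is its own parent. -/
noncomputable def parent (G : SimpleGraph V) (r c : V) : V :=
  if h : ∃ p, IsChild G r p c then h.choose else c

theorem parent_eq (hG : G.IsTree) {p c : V} (h : IsChild G r p c) : parent G r c = p := by
  have h' : ∃ p, IsChild G r p c := ⟨p, h⟩
  rw [parent, dif_pos h']
  exact isChild_unique hG h'.choose_spec h

theorem parent_root : parent G r r = r :=
  dif_neg fun ⟨p, h⟩ => not_isChild_root p h

theorem isChild_parent (hG : G.IsTree) {c : V} (hc : c ≠ r) : IsChild G r (parent G r c) c := by
  obtain ⟨p, hp⟩ := exists_isChild hG hc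
  rwa [parent_eq hG hp]

theorem isChild_iff_adj_and_ne_parent (hG : G.IsTree) {v w : V} :
    IsChild G r v w ↔ G.Adj v w ∧ w ≠ parent G r v := by
  constructor
  · refine fun h => ⟨h.1, ?_⟩
    rintro rfl
    obtain rfl | hv := eq_or_ne v r
    · exact not_isChild_root _ (by rwa [parent_root] at h)
    · have := (isChild_parent hG hv).2
      have := h.2
      omega
  · rintro ⟨hadj, hne⟩
    exact (isChild_or_isChild_of_adj hG r hadj).resolve_right fun h => hne (parent_eq hG h).symm

section AncestorSum

variable [Fintype V] {M : Type*} [AddCommMonoid M] {f : V → M}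

open Classical in
/-- The sum of `f` over the path from the root to `v`. -/
noncomputable def ancestorSum (G : SimpleGraph V) (r : V) (f : V → M) (v : V) : M :=
  ∑ u with IsAncestor G r u v, f u

theorem ancestorSum_root : ancestorSum G r f r = f r := by
  classical
  have ancestors_eq : ({u | IsAncestor G r u r} : Finset V) = {r} := by
    ext u
    rw [mem_filter_univ, mem_singleton]
    exact ⟨eq_root_of_isAncestor_root, fun hu => hu ▸ .refl⟩
  rw [ancestorSum, ancestors_eq, sum_singleton]

theorem ancestorSum_child (hG : G.IsTree) {p c : V} (h : IsChild G r p c) :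
    ancestorSum G r f c = ancestorSum G r f p + f c := by
  classical
  have ancestors_eq : ({u | IsAncestor G r u c} : Finset V)
      = cons c {u | IsAncestor G r u p} (by simpa using not_isAncestor_of_isChild h) := by
    ext u
    simp only [mem_filter_univ, mem_cons]
    exact ⟨fun hu => eq_or_isAncestor_of_isChild hG hu h,
      fun hu => hu.elim (fun hu => hu ▸ .refl) (fun hu => hu.tail h)⟩
  rw [ancestorSum, ancestors_eq, sum_cons, add_comm, ancestorSum]

theorem apply_root_le_ancestorSum [PartialOrder M] [CanonicallyOrderedAdd M]
    [IsOrderedAddMonoid M] (hG : G.IsTree) (v : V) : f r ≤ ancestorSum G r f v := by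
  classical
  exact single_le_sum_of_canonicallyOrdered (f := f)
    ((mem_filter_univ (p := fun u => IsAncestor G r u v) r).2 (isAncestor_root hG v))

theorem ancestorSum_le [PartialOrder M] [IsOrderedAddMonoid M] (hG : G.IsTree) {a : M}
    (hf : ∀ u, f u ≤ a) (v : V) : ancestorSum G r f v ≤ f r + G.dist r v • a := by
  induction isAncestor_root (r := r) hG v with
  | refl => rw [ancestorSum_root, SimpleGraph.dist_self, zero_smul, add_zero]
  | tail _ hc ih =>
    rw [ancestorSum_child hG hc, hc.2, succ_nsmul, ← add_assoc]
    exact add_le_add ih (hf _)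

end AncestorSum

/-- `ch v` lists the children of `v`, each once. -/
def IsChildLists (G : SimpleGraph V) (r : V) (ch : V → List V) : Prop :=
  ∀ v, (ch v).Nodup ∧ ∀ w, w ∈ ch v ↔ IsChild G r v w

theorem exists_isChildLists [Finite V] (G : SimpleGraph V) (r : V) :
    ∃ ch, IsChildLists G r ch := by
  have := Fintype.ofFinite V
  classical
  exact ⟨fun v => ({w | IsChild G r v w} : Finset V).toList, fun v =>
    ⟨nodup_toList _, fun w => by rw [mem_toList, mem_filter_univ]⟩⟩

theorem IsChildLists.eq_nil_iff_isLeaf {ch : V → List V} (hch : IsChildLists G r ch) {v : V} :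
    ch v = [] ↔ IsLeaf G r v := by
  simp only [List.eq_nil_iff_forall_not_mem, (hch v).2, IsLeaf]

variable [Fintype V]

open Classical in
/-- The number of leaves in the subtree of `v`. -/
noncomputable def leaves (G : SimpleGraph V) (r v : V) : ℕ :=
  #{u | IsLeaf G r u ∧ IsAncestor G r v u}

theorem leaves_root (hG : G.IsTree) : leaves G r r = leafCount G r := by
  simp only [leaves, isAncestor_root hG, and_true, leafCount, ← Set.ncard_coe_finset,
    coe_filter_univ]

theorem leaves_pos (v : V) : 0 < leaves G r v := by
  classical
  obtain ⟨u, hu, hmax⟩ := exists_max_image ({u | IsAncestor G r v u} : Finset V) (G.dist r)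
    ⟨v, (mem_filter_univ v).2 .refl⟩
  rw [mem_filter_univ] at hu
  refine card_pos.2 ⟨u, (mem_filter_univ u).2 ⟨fun w hw => ?_, hu⟩⟩
  exact (hmax w ((mem_filter_univ w).2 (hu.tail hw))).not_gt (hw.2 ▸ Nat.lt_succ_self _)

theorem leaves_of_isLeaf {v : V} (hv : IsLeaf G r v) : leaves G r v = 1 := by
  classical
  refine card_eq_one.2 ⟨v, ?_⟩
  ext u
  rw [mem_filter_univ, mem_singleton]
  constructor
  · rintro ⟨-, hu⟩
    obtain rfl | ⟨w, hw, -⟩ := hu.cases_head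
    · rfl
    · exact absurd hw (hv w)
  · rintro rfl
    exact ⟨hv, .refl⟩

theorem leaves_eq_sum (hG : G.IsTree) {ch : V → List V} (hch : IsChildLists G r ch) {v : V}
    (hv : ¬ IsLeaf G r v) : leaves G r v = ((ch v).map (leaves G r)).sum := by
  classical
  have leaves_below_eq : ({u | IsLeaf G r u ∧ IsAncestor G r v u} : Finset V)
      = (ch v).toFinset.biUnion fun c => {u | IsLeaf G r u ∧ IsAncestor G r c u} := by
    ext u
    simp only [mem_filter_univ, mem_biUnion, List.mem_toFinset, (hch v).2]
    constructor
    · rintro ⟨hu, hvu⟩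
      obtain rfl | ⟨c, hc, hcu⟩ := hvu.cases_head
      · exact absurd hu hv
      · exact ⟨c, hc, hu, hcu⟩
    · rintro ⟨c, hc, hu, hcu⟩
      exact ⟨hu, hcu.head hc⟩
  rw [leaves, leaves_below_eq, card_biUnion, ← List.sum_toFinset _ (hch v).1]
  · rfl
  · refine fun c hc c' hc' hne => disjoint_filter.2 fun u _ hu hu' => hne ?_
    rw [mem_coe, List.mem_toFinset, (hch v).2] at hc hc'
    exact sibling_eq_of_isAncestor hG hc hc' hu.2 hu'.2

variable {ch : V → List V}

open Classical in
/-- The number of leaves in the subtrees of the siblings listed before `c`. -/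
noncomputable def leavesBefore (G : SimpleGraph V) (r : V) (ch : V → List V) (c : V) : ℕ :=
  if c = r then 0 else (((ch (parent G r c)).takeWhile (· ≠ c)).map (leaves G r)).sum

/-- The number of leaves that the preorder traversal with children in the order `ch` meets
before `v`. -/
noncomputable def firstLeaf (G : SimpleGraph V) (r : V) (ch : V → List V) (v : V) : ℕ :=
  ancestorSum G r (leavesBefore G r ch) v

theorem firstLeaf_root : firstLeaf G r ch r = 0 := by
  rw [firstLeaf, ancestorSum_root, leavesBefore, if_pos rfl]

theorem firstLeaf_child (hG : G.IsTree) (hch : IsChildLists G r ch) {p c : V} {l₁ l₂ : List V}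
    (h : ch p = l₁ ++ c :: l₂) :
    firstLeaf G r ch c = firstLeaf G r ch p + (l₁.map (leaves G r)).sum := by
  classical
  have hc : IsChild G r p c := ((hch p).2 c).1 (by simp [h])
  have c_ne : c ≠ r := by
    rintro rfl
    exact not_isChild_root p hc
  have c_notMem : c ∉ l₁ := fun hm =>
    (List.nodup_append.1 (h ▸ (hch p).1)).2.2 c hm c List.mem_cons_self rfl
  rw [firstLeaf, ancestorSum_child hG hc, leavesBefore, if_neg c_ne, parent_eq hG hc, h,
    List.takeWhile_append_of_pos fun a ha => decide_eq_true (ne_of_mem_of_not_mem ha c_notMem),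
    List.takeWhile_cons_of_neg (by simp), List.append_nil, firstLeaf]

theorem firstLeaf_nested (hG : G.IsTree) (hch : IsChildLists G r ch) {p c : V}
    (hc : IsChild G r p c) :
    firstLeaf G r ch p ≤ firstLeaf G r ch c ∧
      firstLeaf G r ch c + leaves G r c ≤ firstLeaf G r ch p + leaves G r p := by
  obtain ⟨l₁, l₂, hl⟩ := List.append_of_mem (((hch p).2 c).2 hc)
  rw [firstLeaf_child hG hch hl, leaves_eq_sum hG hch (fun h => h c hc), hl]
  simp only [List.map_append, List.map_cons, List.sum_append, List.sum_cons]
  omega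

theorem firstLeaf_disjoint (hG : G.IsTree) (hch : IsChildLists G r ch) {p c c' : V}
    (hc : IsChild G r p c) (hc' : IsChild G r p c') (hne : c ≠ c') :
    firstLeaf G r ch c + leaves G r c ≤ firstLeaf G r ch c' ∨
      firstLeaf G r ch c' + leaves G r c' ≤ firstLeaf G r ch c := by
  have le_of_split {a b : V} {l₁ l₂ l₃ : List V} (h : ch p = l₁ ++ a :: (l₂ ++ b :: l₃)) :
      firstLeaf G r ch a + leaves G r a ≤ firstLeaf G r ch b := by
    rw [firstLeaf_child hG hch h,
      firstLeaf_child hG hch (c := b) (l₁ := l₁ ++ a :: l₂) (l₂ := l₃) (by simpa using h)]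
    simp only [List.map_append, List.map_cons, List.sum_append, List.sum_cons]
    omega
  obtain ⟨l₁, l₂, hl⟩ := List.append_of_mem (((hch p).2 c).2 hc)
  have c'_mem := ((hch p).2 c').2 hc'
  rw [hl, List.mem_append, List.mem_cons] at c'_mem
  obtain hm | rfl | hm := c'_mem
  · obtain ⟨m₁, m₂, rfl⟩ := List.append_of_mem hm
    exact Or.inr (le_of_split (by simpa using hl))
  · exact absurd rfl hne
  · obtain ⟨m₁, m₂, rfl⟩ := List.append_of_mem hm
    exact Or.inl (le_of_split hl)

theorem firstLeaf_add_leaves_le (hG : G.IsTree) (hch : IsChildLists G r ch) (v : V) :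
    firstLeaf G r ch v + leaves G r v ≤ leafCount G r := by
  rw [← leaves_root hG]
  induction isAncestor_root (r := r) hG v with
  | refl => rw [firstLeaf_root, zero_add]
  | tail _ hc ih => exact (firstLeaf_nested hG hch hc).2.trans ih

theorem firstLeaf_lt (hG : G.IsTree) (hch : IsChildLists G r ch) (v : V) :
    firstLeaf G r ch v < leafCount G r :=
  (Nat.lt_add_of_pos_right (leaves_pos v)).trans_le (firstLeaf_add_leaves_le hG hch v)

end Drawing

/-! ### Drawing the tree with Pythagorean vectors -/

namespace Drawing

open RootedTree Fractions

variable {V : Type u} {G : SimpleGraph V} {r : V}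

/-- The Pythagorean vector `(a² - b², 2ab)` of the fraction `b / a`, encoded as `(a, b)`. It has the
integer length `a² + b²` and the angle `2 arctan (b / a)`. -/
def pythagorean (f : ℕ × ℕ) : ℕ × ℕ := (f.1 * f.1 - f.2 * f.2, 2 * (f.1 * f.2))

theorem pythagorean_le (f : ℕ × ℕ) {m : ℕ} (h₁ : f.1 ≤ m) (h₂ : f.2 ≤ m) :
    pythagorean f ≤ (2 * m ^ 2, 2 * m ^ 2) := by
  have := Nat.mul_le_mul h₁ h₁
  have := Nat.mul_le_mul h₁ h₂
  rw [Prod.le_def, pythagorean, sq]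
  dsimp only
  omega

theorem pythagorean_le_of_admissible {N : ℕ} {f : ℕ × ℕ} (h : Admissible N f) :
    pythagorean f ≤ (N - 1, N - 1) := by
  have := h.sq_lt
  have := h.mul_lt
  rw [Prod.le_def, pythagorean]
  dsimp only
  omega

theorem pythagorean_sum_pos {N : ℕ} {f : ℕ × ℕ} (h : Admissible N f) :
    0 < (pythagorean f).1 + (pythagorean f).2 := by
  have sq_pos := Nat.mul_pos h.pos h.pos
  obtain hzero | hpos := f.2.eq_zero_or_pos
  · simpa only [pythagorean, hzero, mul_zero, Nat.sub_zero, add_zero] using sq_pos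
  · exact Nat.add_pos_right _ (Nat.mul_pos two_pos (Nat.mul_pos h.pos hpos))

theorem cast_pythagorean_fst {R : Type*} [Ring R] {f : ℕ × ℕ} (h : f.2 ≤ f.1) :
    ((pythagorean f).1 : R) = f.1 * f.1 - f.2 * f.2 := by
  rw [pythagorean, Nat.cast_sub (Nat.mul_le_mul h h), Nat.cast_mul, Nat.cast_mul]

theorem pythagorean_cross_pos {N : ℕ} {f g : ℕ × ℕ} (hf : Admissible N f) (hg : Admissible N g)
    (hlt : value f < value g) :
    (0 : ℝ) < (pythagorean f).1 * (pythagorean g).2 - (pythagorean f).2 * (pythagorean g).1 := by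
  have cross_lt : (f.2 * g.1 : ℝ) < g.2 * f.1 := mod_cast (value_lt_value hf.pos hg.pos).1 hlt
  have fst_pos : (0 : ℝ) < f.1 * g.1 := mod_cast Nat.mul_pos hf.pos hg.pos
  rw [cast_pythagorean_fst hf.le, cast_pythagorean_fst hg.le]
  simp only [pythagorean]
  push_cast
  calc (0 : ℝ) < 2 * (f.1 * g.1 + f.2 * g.2) * (g.2 * f.1 - f.2 * g.1) := by
        have := sub_pos.2 cross_lt
        positivity
    _ = _ := by ring

/-- A point with natural coordinates as a grid point. -/
def natPoint (p : ℕ × ℕ) : ℤ × ℤ := (p.1, p.2)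

theorem natPoint_add (p q : ℕ × ℕ) : natPoint (p + q) = natPoint p + natPoint q := by
  simp [natPoint]

theorem toPlane_add (p q : ℤ × ℤ) : toPlane (p + q) = toPlane p + toPlane q := by
  ext i
  fin_cases i <;> simp [toPlane]

theorem norm_toPlane_pythagorean {f : ℕ × ℕ} (h : f.2 ≤ f.1) :
    ‖toPlane (natPoint (pythagorean f))‖ = (f.1 ^ 2 + f.2 ^ 2 : ℕ) := by
  rw [EuclideanSpace.norm_eq, Fin.sum_univ_two]
  simp only [toPlane, natPoint, Int.cast_natCast, PiLp.toLp_apply, Matrix.cons_val_zero,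
    Matrix.cons_val_one, Real.norm_natCast]
  rw [Real.sqrt_eq_iff_eq_sq (by positivity) (by positivity), cast_pythagorean_fst h]
  simp only [pythagorean]
  push_cast
  ring

/-- The cross product `x₀ y₁ - x₁ y₀`, positive if `y` lies counterclockwise of `x`. -/
noncomputable def crossProduct : LinearMap.BilinForm ℝ (EuclideanSpace ℝ (Fin 2)) :=
  LinearMap.mk₂ ℝ (fun x y => x 0 * y 1 - x 1 * y 0)
    (fun _ _ _ => by simp only [PiLp.add_apply]; ring)
    (fun _ _ _ => by simp only [PiLp.smul_apply, smul_eq_mul]; ring)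
    (fun _ _ _ => by simp only [PiLp.add_apply]; ring)
    (fun _ _ _ => by simp only [PiLp.smul_apply, smul_eq_mul]; ring)

theorem isAlt_crossProduct : crossProduct.IsAlt := fun x => by
  rw [crossProduct, LinearMap.mk₂_apply, mul_comm, sub_self]

/-- The sum of the coordinates, by which all vectors in the first quadrant point upwards. -/
noncomputable def coordSum : Module.Dual ℝ (EuclideanSpace ℝ (Fin 2)) :=
  (EuclideanSpace.proj 0 + EuclideanSpace.proj 1 : EuclideanSpace ℝ (Fin 2) →L[ℝ] ℝ)

theorem coordSum_toPlane (p : ℤ × ℤ) : coordSum (toPlane p) = p.1 + p.2 := rfl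

/-- The strict upper bound for the coordinates of the vectors that represent edges. -/
noncomputable def coordBound (G : SimpleGraph V) (r : V) : ℕ := 13 * leafCount G r / 2

/-- The `k`-th vector by angle among the Pythagorean vectors of admissible fractions. -/
def direction (N k : ℕ) : ℕ × ℕ := pythagorean (enum N k)

section Finite

variable [Finite V]

theorem leafCount_pos (hG : G.IsTree) : 0 < leafCount G r := by
  have := Fintype.ofFinite V
  exact leaves_root hG ▸ leaves_pos r

theorem one_lt_coordBound (hG : G.IsTree) : 1 < coordBound G r := by
  have := leafCount_pos (r := r) hG
  rw [coordBound]
  omega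

theorem admissible_enum_coordBound (hG : G.IsTree) {k : ℕ} (hk : k < leafCount G r) :
    Admissible (coordBound G r) (enum (coordBound G r) k) :=
  (enum_spec (hk.trans_le (le_card_values (leafCount_pos hG)))).1

theorem value_enum_lt_value_enum (hG : G.IsTree) {i j : ℕ} (hij : i < j) (hj : j < leafCount G r) :
    value (enum (coordBound G r) i) < value (enum (coordBound G r) j) := by
  have hj' := hj.trans_le (le_card_values (leafCount_pos hG))
  exact enum_strictMonoOn _ (hij.trans hj') hj' hij

end Finite

variable [Fintype V] {ch : V → List V}

/-- The position of `v` in the drawing in which the edge from the parent of `u` to `u` is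
`direction N (firstLeaf G r ch u)`; the root is moved by such a vector, too. -/
noncomputable def position (G : SimpleGraph V) (r : V) (ch : V → List V) (N : ℕ) (v : V) : ℕ × ℕ :=
  ancestorSum G r (fun u => direction N (firstLeaf G r ch u)) v

/-- The position of `v` in the drawing with the vectors below the bound `coordBound G r`. -/
noncomputable def gridPos (G : SimpleGraph V) (r : V) (ch : V → List V) (v : V) : ℤ × ℤ :=
  natPoint (position G r ch (coordBound G r) v)

theorem toPlane_gridPos_sub (hG : G.IsTree) {p c : V} (hc : IsChild G r p c) :
    toPlane (gridPos G r ch c) - toPlane (gridPos G r ch p)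
      = toPlane (natPoint (direction (coordBound G r) (firstLeaf G r ch c))) := by
  rw [gridPos, position, ancestorSum_child hG hc, natPoint_add, toPlane_add, gridPos, position,
    add_sub_cancel_left]

theorem isLayout_gridPos (hG : G.IsTree) (hch : IsChildLists G r ch) :
    IsLayout G r crossProduct coordSum (fun v => toPlane (gridPos G r ch v)) fun v =>
      (fun k => toPlane (natPoint (direction (coordBound G r) k))) ''
        Set.Ico (firstLeaf G r ch v) (firstLeaf G r ch v + leaves G r v) where
  vector_mem p c hc := ⟨firstLeaf G r ch c,
    ⟨le_rfl, Nat.lt_add_of_pos_right (leaves_pos c)⟩, (toPlane_gridPos_sub hG hc).symm⟩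
  subset p c hc :=
    have ⟨le, add_le⟩ := firstLeaf_nested hG hch hc
    Set.image_mono (Set.Ico_subset_Ico le add_le)
  height_pos v := by
    rintro _ ⟨k, hk, rfl⟩
    have := pythagorean_sum_pos
      (admissible_enum_coordBound hG (hk.2.trans_le (firstLeaf_add_leaves_le hG hch v)))
    simp only [coordSum_toPlane, natPoint, direction]
    exact_mod_cast this
  separated q c c' hc hc' hne := by
    have cross_pos {u v : V} (huv : firstLeaf G r ch u + leaves G r u ≤ firstLeaf G r ch v) {i j}
        (hi : i ∈ Set.Ico (firstLeaf G r ch u) (firstLeaf G r ch u + leaves G r u))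
        (hj : j ∈ Set.Ico (firstLeaf G r ch v) (firstLeaf G r ch v + leaves G r v)) :
        0 < crossProduct (toPlane (natPoint (direction (coordBound G r) i)))
          (toPlane (natPoint (direction (coordBound G r) j))) := by
      have hij : i < j := hi.2.trans_le (huv.trans hj.1)
      have hjt : j < leafCount G r := hj.2.trans_le (firstLeaf_add_leaves_le hG hch v)
      exact pythagorean_cross_pos (admissible_enum_coordBound hG (hij.trans hjt))
        (admissible_enum_coordBound hG hjt) (value_enum_lt_value_enum hG hij hjt)
    refine (firstLeaf_disjoint hG hch hc hc' hne).imp (fun hle => ?_) (fun hle => ?_)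
    · rintro _ ⟨i, hi, rfl⟩ _ ⟨j, hj, rfl⟩
      exact cross_pos hle hi hj
    · rintro _ ⟨i, hi, rfl⟩ _ ⟨j, hj, rfl⟩
      exact cross_pos hle hj hi

theorem isTrulyIntegralFary_gridPos (hG : G.IsTree) (hch : IsChildLists G r ch) :
    IsTrulyIntegralFary G (gridPos G r ch) where
  fary := (isLayout_gridPos hG hch).isFary hG isAlt_crossProduct
  integral u v hadj := by
    wlog huv : IsChild G r u v generalizing u v
    · rw [dist_comm]
      exact this v u hadj.symm ((isChild_or_isChild_of_adj hG r hadj).resolve_left huv)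
    rw [dist_comm, dist_eq_norm, toPlane_gridPos_sub hG huv]
    exact ⟨_, norm_toPlane_pythagorean (admissible_enum_coordBound hG (firstLeaf_lt hG hch v)).le⟩

theorem position_mem_Icc (hG : G.IsTree) (hch : IsChildLists G r ch) (v : V) :
    position G r ch (coordBound G r) v ∈ Set.Icc (position G r ch (coordBound G r) r)
      (position G r ch (coordBound G r) r
        + depth G r • (coordBound G r - 1, coordBound G r - 1)) := by
  have dist_le : G.dist r v ≤ depth G r :=
    Finset.le_sup (f := fun v => G.dist r v) (Finset.mem_univ v)
  have direction_le (u : V) : direction (coordBound G r) (firstLeaf G r ch u)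
      ≤ (coordBound G r - 1, coordBound G r - 1) :=
    pythagorean_le_of_admissible (admissible_enum_coordBound hG (firstLeaf_lt hG hch u))
  simp only [position]
  rw [ancestorSum_root]
  have root_le := apply_root_le_ancestorSum (r := r)
    (f := fun u => direction (coordBound G r) (firstLeaf G r ch u)) hG v
  exact ⟨root_le, (ancestorSum_le hG direction_le v).trans
    (add_le_add_right (nsmul_le_nsmul_left zero_le dist_le) _)⟩

theorem depth_mul_coordBound_le (hG : G.IsTree) :
    ((depth G r * (coordBound G r - 1) + 1 : ℕ) : ℝ)
      ≤ max 1 (2 * Real.pi ^ 2 / 3 * leafCount G r * depth G r) := by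
  obtain hd | hd := (depth G r).eq_zero_or_pos
  · simp [hd]
  apply le_max_of_le_right
  have coordBound_le : (coordBound G r : ℝ) ≤ 13 / 2 * leafCount G r := by
    have := @Nat.cast_div_le ℝ _ _ _ (13 * leafCount G r) 2
    push_cast at this
    exact this.trans_eq (by ring)
  have pi_sq_ge : (13 / 2 : ℝ) ≤ 2 * Real.pi ^ 2 / 3 := by nlinarith [Real.pi_gt_d2]
  calc ((depth G r * (coordBound G r - 1) + 1 : ℕ) : ℝ)
      ≤ (depth G r * (coordBound G r - 1 + 1) : ℕ) := by
        rw [mul_add_one]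
        gcongr
        exact hd
    _ = coordBound G r * depth G r := by
        rw [Nat.sub_add_cancel (one_lt_coordBound hG).le, Nat.cast_mul, mul_comm]
    _ ≤ 13 / 2 * leafCount G r * depth G r := by gcongr
    _ ≤ 2 * Real.pi ^ 2 / 3 * leafCount G r * depth G r := by gcongr

theorem onGrid_gridPos (hG : G.IsTree) (hch : IsChildLists G r ch) :
    OnGrid (gridPos G r ch) (max 1 (2 * Real.pi ^ 2 / 3 * leafCount G r * depth G r))
      (max 1 (2 * Real.pi ^ 2 / 3 * leafCount G r * depth G r)) := by
  refine ⟨_, _, depth_mul_coordBound_le hG, depth_mul_coordBound_le hG,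
    (gridPos G r ch r).1, (gridPos G r ch r).2, fun v => ?_⟩
  have := position_mem_Icc hG hch v
  simp only [Set.mem_Icc, Prod.le_def, Prod.fst_add, Prod.snd_add, Prod.smul_fst, Prod.smul_snd,
    smul_eq_mul] at this
  simp only [gridPos, natPoint]
  omega

theorem leafCount_le_card : leafCount G r ≤ Fintype.card V :=
  (Set.ncard_le_card _).trans_eq Nat.card_eq_fintype_card

theorem gridSize_le (hG : G.IsTree) :
    max 1 (2 * Real.pi ^ 2 / 3 * leafCount G r * depth G r) ≤ 11 * (Fintype.card V : ℝ) ^ 2 := by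
  have one_le_card : (1 : ℝ) ≤ Fintype.card V := mod_cast Fintype.card_pos_iff.2 ⟨r⟩
  have leafCount_le : (leafCount G r : ℝ) ≤ Fintype.card V := mod_cast leafCount_le_card
  have depth_le : (depth G r : ℝ) ≤ Fintype.card V := by
    exact_mod_cast Finset.sup_le fun v _ => (dist_lt_card hG v).le
  have pi_sq_le : 2 * Real.pi ^ 2 / 3 ≤ 11 := by nlinarith [Real.pi_le_four, Real.pi_pos]
  apply max_le
  · nlinarith
  · calc 2 * Real.pi ^ 2 / 3 * leafCount G r * depth G r
        ≤ 11 * Fintype.card V * Fintype.card V := by gcongr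
      _ = 11 * (Fintype.card V : ℝ) ^ 2 := by ring

end Drawing

/-! ### Verifying programs for the random access machine -/

namespace RAM

variable {B : ℕ}

/-- Started in `s`, the program `p` halts after at most `T` steps in a state with property `Q`, and
all numbers written on the way are at most `B`. -/
def Run (B : ℕ) (p : Prog) (s : State) (T : ℕ) (Q : State → Prop) : Prop :=
  ∃ s' T', Exec B p s s' T' ∧ T' ≤ T ∧ Q s'

/-- A sequence of programs. -/
def block : List Prog → Prog
  | [] => .skip
  | p :: l => .seq p (block l)

/-- If `R i ≠ R j` then `p`. -/
def ifNe (i j : ℕ) (p : Prog) : Prog := .cond i j p (.cond j i p .skip)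

@[simp] theorem State.reg_setReg (s : State) (i x j : ℕ) :
    (s.setReg i x).reg j = if j = i then x else s.reg j :=
  Function.update_apply ..

@[simp] theorem State.mem_setReg (s : State) (i x : ℕ) : (s.setReg i x).mem = s.mem := rfl

@[simp] theorem State.reg_setMem (s : State) (a x : ℕ) : (s.setMem a x).reg = s.reg := rfl

@[simp] theorem State.mem_setMem (s : State) (a x b : ℕ) :
    (s.setMem a x).mem b = if b = a then x else s.mem b :=
  Function.update_apply ..

section Run

variable {p q : Prog} {l : List Prog} {s : State} {o : BinOp} {i j k T : ℕ} {Q : State → Prop}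

theorem Run.mono {T' : ℕ} {Q' : State → Prop} (h : Run B p s T Q) (hT : T ≤ T')
    (hQ : ∀ s, Q s → Q' s) : Run B p s T' Q' :=
  have ⟨s', T₁, hexec, hT₁, hs'⟩ := h
  ⟨s', T₁, hexec, hT₁.trans hT, hQ s' hs'⟩

theorem Run.skip (hT : 1 ≤ T) (h : Q s) : Run B .skip s T Q := ⟨s, 1, .skip s, hT, h⟩

theorem Run.nil (h : Q s) : Run B (block []) s (T + 1) Q := .skip (Nat.le_add_left 1 T) h

theorem Run.cons (T₁ T₂ : ℕ) (h : Run B p s T₁ fun s' => Run B (block l) s' T₂ Q)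
    (hT : T₁ + T₂ ≤ T) : Run B (block (p :: l)) s T Q :=
  have ⟨_, T₁', hp, hT₁, s'', T₂', hl, hT₂, hs''⟩ := h
  ⟨s'', T₁' + T₂', .seq hp hl, (Nat.add_le_add hT₁ hT₂).trans hT, hs''⟩

theorem Run.cons_const (hB : k ≤ B) (h : Run B (block l) (s.setReg i k) T Q) :
    Run B (block (.const i k :: l)) s (T + 1) Q :=
  .cons 1 T ⟨_, 1, .const s i k hB, le_rfl, h⟩ (Nat.add_comm 1 T).le

theorem Run.cons_op (x : ℕ) (hx : o.eval (s.reg j) (s.reg k) = x) (hB : x ≤ B)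
    (h : Run B (block l) (s.setReg i x) T Q) : Run B (block (.op o i j k :: l)) s (T + 1) Q := by
  subst hx
  exact .cons 1 T ⟨_, 1, .op s o i j k hB, le_rfl, h⟩ (Nat.add_comm 1 T).le

theorem Run.cons_load (x : ℕ) (hx : s.mem (s.reg j) = x) (hB : x ≤ B)
    (h : Run B (block l) (s.setReg i x) T Q) : Run B (block (.load i j :: l)) s (T + 1) Q := by
  subst hx
  exact .cons 1 T ⟨_, 1, .load s i j hB, le_rfl, h⟩ (Nat.add_comm 1 T).le

theorem Run.cons_store (a x : ℕ) (ha : s.reg i = a) (hx : s.reg j = x) (hB : x ≤ B)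
    (h : Run B (block l) (s.setMem a x) T Q) : Run B (block (.store i j :: l)) s (T + 1) Q := by
  subst hx ha
  exact .cons 1 T ⟨_, 1, .store s i j hB, le_rfl, h⟩ (Nat.add_comm 1 T).le

theorem Run.cond (hp : s.reg i < s.reg j → Run B p s T Q)
    (hq : ¬ s.reg i < s.reg j → Run B q s T Q) : Run B (.cond i j p q) s (T + 1) Q := by
  by_cases h : s.reg i < s.reg j
  · obtain ⟨s', T', hexec, hT', hs'⟩ := hp h
    exact ⟨s', T' + 1, .cond_true h hexec, Nat.succ_le_succ hT', hs'⟩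
  · obtain ⟨s', T', hexec, hT', hs'⟩ := hq h
    exact ⟨s', T' + 1, .cond_false h hexec, Nat.succ_le_succ hT', hs'⟩

theorem Run.ifNe (hT : 1 ≤ T) (hp : s.reg i ≠ s.reg j → Run B p s T Q)
    (hQ : s.reg i = s.reg j → Q s) : Run B (ifNe i j p) s (T + 2) Q :=
  .cond (fun hlt => (hp hlt.ne).mono T.le_succ fun _ => id) fun hge =>
    .cond (fun hgt => hp hgt.ne') fun hle => .skip hT (hQ (Nat.le_antisymm (not_lt.1 hle)
      (not_lt.1 hge)))

/-- The first argument of the invariant `I` is the time left. -/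
theorem Run.loop (I : ℕ → State → Prop)
    (hstep : ∀ τ s, I τ s → s.reg i < s.reg j → ∃ T τ', T + 1 + τ' ≤ τ ∧ Run B p s T (I τ'))
    (hexit : ∀ τ s, I τ s → ¬ s.reg i < s.reg j → 1 ≤ τ ∧ Q s) {τ : ℕ} (h : I τ s) :
    Run B (.loop i j p) s τ Q := by
  induction τ using Nat.strong_induction_on generalizing s with
  | _ τ ih =>
    by_cases hlt : s.reg i < s.reg j
    · obtain ⟨T, τ', hτ, s', T', hexec, hT', hs'⟩ := hstep τ s h hlt
      obtain ⟨s'', T'', hloop, hT'', hs''⟩ := ih τ' (by omega) hs'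
      exact ⟨s'', _, .loop_true hlt hexec hloop, by omega, hs''⟩
    · obtain ⟨hτ, hs⟩ := hexit τ s h hlt
      exact ⟨s, 1, .loop_false hlt, hτ, hs⟩

theorem Run.for_loop (I : ℕ → State → Prop) (m T : ℕ)
    (hlt : ∀ k ≤ m, ∀ s, I k s → (s.reg i < s.reg j ↔ k < m))
    (hstep : ∀ k < m, ∀ s, I k s → Run B p s T (I (k + 1))) (h : I 0 s) :
    Run B (.loop i j p) s (m * (T + 1) + 1) (I m) := by
  refine Run.loop (fun τ s => ∃ k ≤ m, τ = (m - k) * (T + 1) + 1 ∧ I k s) ?_ ?_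
    ⟨0, Nat.zero_le m, rfl, h⟩
  · rintro τ s ⟨k, hk, rfl, hI⟩ hij
    have hkm : k < m := (hlt k hk s hI).1 hij
    refine ⟨T, (m - (k + 1)) * (T + 1) + 1, ?_, (hstep k hkm s hI).mono le_rfl fun s hs =>
      ⟨k + 1, hkm, rfl, hs⟩⟩
    have hsub : m - k = m - (k + 1) + 1 := by omega
    rw [hsub, add_mul]
    omega
  · rintro τ s ⟨k, hk, rfl, hI⟩ hij
    obtain rfl : k = m := hk.eq_of_not_lt ((hlt k hk s hI).not.1 hij)
    exact ⟨Nat.le_add_left .., hI⟩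

end Run

/-- The registers below `m` are the same in both states. -/
def EqBelow (m : ℕ) (s s' : State) : Prop := ∀ i < m, s'.reg i = s.reg i

section EqBelow

variable {m : ℕ} {s s' : State}

@[simp] theorem EqBelow.refl : EqBelow m s s := fun _ _ => rfl

theorem EqBelow.trans {s'' : State} (h : EqBelow m s s') (h' : EqBelow m s' s'') :
    EqBelow m s s'' := fun i hi => (h' i hi).trans (h i hi)

theorem EqBelow.mono {l : ℕ} (h : EqBelow m s s') (hl : l ≤ m) : EqBelow l s s' :=
  fun i hi => h i (hi.trans_le hl)

@[simp] theorem eqBelow_setReg_iff {i x : ℕ} (hi : m ≤ i) :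
    EqBelow m s (s'.setReg i x) ↔ EqBelow m s s' := by
  refine forall₂_congr fun j hj => ?_
  rw [State.reg_setReg, if_neg (hj.trans_le hi).ne]

@[simp] theorem setReg_eqBelow_iff {i x : ℕ} (hi : m ≤ i) :
    EqBelow m (s.setReg i x) s' ↔ EqBelow m s s' := by
  refine forall₂_congr fun j hj => ?_
  rw [State.reg_setReg, if_neg (hj.trans_le hi).ne]

@[simp] theorem eqBelow_setMem_iff {a x : ℕ} :
    EqBelow m s (s'.setMem a x) ↔ EqBelow m s s' := Iff.rfl

end EqBelow

/-- The contents of two consecutive registers, which hold a fraction. -/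
def State.pair (s : State) (i : ℕ) : ℕ × ℕ := (s.reg i, s.reg (i + 1))

/-! ### The encoding of the input -/

section Encode

variable {n : ℕ} (adj : Fin n → List (Fin n)) (r : Fin n)

/-- The total length of the adjacency lists of the vertices below `k`. -/
def offset (k : ℕ) : ℕ := (((List.finRange n).take k).map fun v => (adj v).length).sum

theorem offset_succ (v : Fin n) : offset adj (v.val + 1) = offset adj v.val + (adj v).length := by
  have hv : v.val < (List.finRange n).length := by simp
  rw [offset, offset, List.take_succ_eq_append_getElem hv]
  simp

theorem offset_mono : Monotone (offset adj) := fun _ _ h =>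
  ((List.take_sublist_take_left h).map _).sum_le_sum fun _ _ => Nat.zero_le _

theorem offset_card : offset adj n = ∑ v, (adj v).length := by
  rw [offset, List.take_of_length_le (List.length_finRange).le, ← List.sum_ofFn,
    List.ofFn_eq_map]

theorem encode_zero : (encode adj r).getD 0 0 = n := rfl

theorem encode_one : (encode adj r).getD 1 0 = r.val := rfl

theorem encode_offset {k : ℕ} (hk : k ≤ n) : (encode adj r).getD (2 + k) 0 = offset adj k := by
  rw [encode, List.append_assoc, List.getD_append_right _ _ _ _ (Nat.le_add_right 2 k),
    List.getD_append _ _ _ _ (by simp; omega)]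
  simp [offset, List.getD_eq_getElem?_getD, Nat.lt_succ_of_le hk]

theorem getD_flatMap {α β : Type*} (f : α → List β) (l : List α) (d : β) {k i : ℕ}
    (hk : k < l.length) (hi : i < (f l[k]).length) :
    (l.flatMap f).getD (((l.take k).map fun v => (f v).length).sum + i) d = (f l[k])[i] := by
  induction l generalizing k with
  | nil => exact absurd hk (Nat.not_lt_zero k)
  | cons a l ih =>
    cases k with
    | zero =>
      rw [List.take_zero, List.map_nil, List.sum_nil, zero_add, List.flatMap_cons]
      exact (List.getD_append _ _ _ _ hi).trans (List.getD_eq_getElem _ _ hi)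
    | succ k =>
      rw [List.flatMap_cons, List.take_succ_cons, List.map_cons, List.sum_cons, add_assoc,
        List.getD_append_right _ _ _ _ (Nat.le_add_right ..), Nat.add_sub_cancel_left]
      exact ih (Nat.lt_of_succ_lt_succ hk) hi

theorem encode_adj (v : Fin n) {i : ℕ} (hi : i < (adj v).length) :
    (encode adj r).getD (n + 3 + (offset adj v.val + i)) 0 = ((adj v)[i]).val := by
  have lookup := getD_flatMap (fun v => (adj v).map Fin.val) (List.finRange n) 0 (k := v.val)
    (i := i) (by simp) (by simpa using hi)
  simp only [List.length_map, List.getElem_finRange, List.getElem_map] at lookup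
  rw [encode, List.getD_append_right _ _ _ _ (by simp)]
  refine Eq.trans ?_ lookup
  congr 1
  simp only [List.length_append, List.length_cons, List.length_nil, List.length_map,
    List.length_range, offset]
  omega

theorem IsAdjLists.length_eq_degree {adj : Fin n → List (Fin n)} {G : SimpleGraph (Fin n)}
    (hadj : IsAdjLists G adj) (v : Fin n) [Fintype (G.neighborSet v)] :
    (adj v).length = G.degree v := by
  rw [← List.toFinset_card_of_nodup (hadj v).1, ← G.card_neighborFinset_eq_degree]
  congr 1
  ext w
  simp [(hadj v).2]

theorem IsAdjLists.sum_length_add_two {adj : Fin n → List (Fin n)} {G : SimpleGraph (Fin n)}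
    (hadj : IsAdjLists G adj) (hG : G.IsTree) : ∑ v, (adj v).length + 2 = 2 * n := by
  classical
  have card_edges := hG.card_edgeFinset
  rw [Fintype.card_fin] at card_edges
  simp only [hadj.length_eq_degree, G.sum_degrees_eq_twice_card_edges]
  omega

end Encode

end RAM

/-! ### Computing the next fraction

Registers that keep their meaning: `R 0 = 0`, `R 1 = n`, `R 2` is the root, `R 3` bounds the
coordinates of the vectors, `R 4 = 1`, and `R 5`, …, `R 9` are the addresses of the parents, the
abscissas, the ordinates, the stack, and the concatenated adjacency lists. The current fraction is
`R 11 / R 10`, and `R 16` is the height of the stack. -/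

namespace RAM

open Fractions

variable {B N : ℕ} {s : State}

/-- `R 24` becomes the numerator of the smallest fraction with denominator `R 20` above the current
one; the other registers prepare its comparison with the best fraction `R 23 / R 22` so far. -/
def candidateProg : Prog := block [
  .op .mul 24 11 20, .op .div 24 24 10, .op .add 24 24 4,
  .op .add 25 20 4, .op .mul 26 20 24, .op .add 26 26 26,
  .op .mul 27 24 22, .op .mul 28 23 20]

/-- Replace the best fraction by the candidate `R 24 / R 20` if that is better and admissible. -/
def updateProg : Prog :=
  .cond 24 25 (.cond 26 3 (.cond 27 28 (block [.op .add 22 20 0, .op .add 23 24 0])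
    .skip) .skip) .skip

/-- Try the denominator `R 20`, and prepare the next one and its square. -/
def searchBody : Prog := block [
  candidateProg, updateProg, .op .add 20 20 4, .op .mul 21 20 20]

/-- Replace the current fraction by the next one. -/
def searchProg : Prog := block [
  .const 20 1, .const 21 1, .const 22 0, .const 23 1,
  .loop 21 3 searchBody,
  .op .add 10 22 0, .op .add 11 23 0]

/-- The comparisons that `updateProg` needs have been prepared for a fraction above `f`. -/
structure IsCandidate (f : ℕ × ℕ) (s : State) : Prop where
  num : s.reg 24 = numeratorAbove f (s.reg 20)
  den_succ : s.reg 25 = s.reg 20 + 1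
  two_mul : s.reg 26 = 2 * (s.reg 20 * s.reg 24)
  cross_num : s.reg 27 = s.reg 24 * s.reg 22
  cross_best : s.reg 28 = s.reg 23 * s.reg 20

theorem run_candidateProg (hB : 4 * (N + 1) ^ 3 ≤ B) (h4 : s.reg 4 = 1) (h11 : s.reg 11 ≤ N + 1)
    (h20 : s.reg 20 ≤ N + 1) (h22 : s.reg 22 ≤ N + 1) (h23 : s.reg 23 ≤ N + 1) :
    Run B candidateProg s 9 fun s' =>
      s'.mem = s.mem ∧ EqBelow 24 s s' ∧ IsCandidate (s.pair 10) s' ∧ s'.reg 24 ≤ B := by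
  have one_le_sq : 1 ≤ (N + 1) ^ 2 := Nat.one_le_pow _ _ N.succ_pos
  have le_cube : N + 1 ≤ (N + 1) ^ 3 := Nat.le_self_pow (by norm_num) _
  have sq_le_cube : (N + 1) ^ 2 ≤ (N + 1) ^ 3 := Nat.pow_le_pow_right N.succ_pos (by norm_num)
  have mul_le {x y : ℕ} (hx : x ≤ N + 1) (hy : y ≤ N + 1) : x * y ≤ (N + 1) ^ 2 :=
    (Nat.mul_le_mul hx hy).trans_eq (sq _).symm
  have prod_le := mul_le h11 h20
  have quot_le : s.reg 11 * s.reg 20 / s.reg 10 ≤ (N + 1) ^ 2 := (Nat.div_le_self _ _).trans prod_le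
  have num_le : numeratorAbove (s.pair 10) (s.reg 20) ≤ 2 * (N + 1) ^ 2 := by
    change s.reg 11 * s.reg 20 / s.reg 10 + 1 ≤ _
    omega
  have mul_num_le {x : ℕ} (hx : x ≤ N + 1) :
      x * numeratorAbove (s.pair 10) (s.reg 20) ≤ 2 * (N + 1) ^ 3 :=
    (Nat.mul_le_mul hx num_le).trans_eq (by ring)
  have den_num_le := mul_num_le h20
  have best_num_le := mul_num_le h22
  have cross_best_le := mul_le h23 h20
  refine .cons_op (s.reg 11 * s.reg 20) rfl (by omega) ?_
  refine .cons_op (s.reg 11 * s.reg 20 / s.reg 10) (by simp [BinOp.eval]) (by omega) ?_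
  refine .cons_op (numeratorAbove (s.pair 10) (s.reg 20))
    (by simp [BinOp.eval, h4, numeratorAbove, State.pair]) (by omega) ?_
  refine .cons_op (s.reg 20 + 1) (by simp [BinOp.eval, h4]) (by omega) ?_
  refine .cons_op (s.reg 20 * numeratorAbove (s.pair 10) (s.reg 20)) (by simp [BinOp.eval])
    (by omega) ?_
  refine .cons_op (2 * (s.reg 20 * numeratorAbove (s.pair 10) (s.reg 20)))
    (by simp [BinOp.eval, two_mul]) (by omega) ?_
  refine .cons_op (s.reg 22 * numeratorAbove (s.pair 10) (s.reg 20))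
    (by simp [BinOp.eval, mul_comm]) (by omega) ?_
  refine .cons_op (s.reg 23 * s.reg 20) (by simp [BinOp.eval]) (by omega) ?_
  exact .nil ⟨rfl, by simp, by constructor <;> simp [mul_comm], by simp; omega⟩

theorem run_updateProg {f : ℕ × ℕ} (h0 : s.reg 0 = 0) (h20 : s.reg 20 ≤ B) (h24 : s.reg 24 ≤ B)
    (h : IsCandidate f s) :
    Run B updateProg s 6 fun s' => s'.mem = s.mem ∧ EqBelow 22 s s' ∧
      s'.pair 22 = searchStep (s.reg 3) f (s.pair 22) (s.reg 20) := by
  have accept_iff : (numeratorAbove f (s.reg 20) ≤ s.reg 20 ∧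
      2 * (s.reg 20 * numeratorAbove f (s.reg 20)) < s.reg 3 ∧
      numeratorAbove f (s.reg 20) * (s.pair 22).1 < (s.pair 22).2 * s.reg 20) ↔
      s.reg 24 < s.reg 25 ∧ s.reg 26 < s.reg 3 ∧ s.reg 27 < s.reg 28 := by
    rw [h.den_succ, h.two_mul, h.cross_num, h.cross_best, h.num, Nat.lt_succ_iff]
    rfl
  have keep {T : ℕ} (hT : 1 ≤ T)
      (hnot : ¬ (s.reg 24 < s.reg 25 ∧ s.reg 26 < s.reg 3 ∧ s.reg 27 < s.reg 28)) :
      Run B .skip s T fun s' => s'.mem = s.mem ∧ EqBelow 22 s s' ∧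
        s'.pair 22 = searchStep (s.reg 3) f (s.pair 22) (s.reg 20) :=
    .skip hT ⟨rfl, .refl, (if_neg (accept_iff.not.2 hnot)).symm⟩
  refine .cond (fun h₁ => .cond (fun h₂ => .cond (fun h₃ => ?_) fun h₃ => ?_) fun h₂ => ?_)
    fun h₁ => ?_
  · refine .cons_op (s.reg 20) (by simp [BinOp.eval, h0]) h20 ?_
    refine .cons_op (s.reg 24) (by simp [BinOp.eval, h0]) h24 ?_
    refine .nil ⟨rfl, by simp, ?_⟩
    rw [searchStep, if_pos (accept_iff.2 ⟨h₁, h₂, h₃⟩), ← h.num]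
    simp [State.pair]
  · exact keep (by norm_num) fun h => h₃ h.2.2
  · exact keep (by norm_num) fun h => h₂ h.2.1
  · exact keep (by norm_num) fun h => h₁ h.1

theorem run_searchBody {f : ℕ × ℕ} {k : ℕ} (hB : 4 * (N + 1) ^ 3 ≤ B) (hk : k < N)
    (h0 : s.reg 0 = 0) (h3 : s.reg 3 = N) (h4 : s.reg 4 = 1) (hf : s.pair 10 = f)
    (hf_le : f.2 ≤ N + 1) (h20 : s.reg 20 = k + 1) (hbest : s.pair 22 = search N f k) :
    Run B searchBody s 18 fun s' => s'.mem = s.mem ∧ EqBelow 20 s s' ∧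
      s'.reg 20 = k + 2 ∧ s'.reg 21 = (k + 2) * (k + 2) ∧ s'.pair 22 = search N f (k + 1) := by
  have le_cube : N + 1 ≤ (N + 1) ^ 3 := Nat.le_self_pow (by norm_num) _
  have sq_le : (k + 2) * (k + 2) ≤ 4 * (N + 1) ^ 3 := by
    calc (k + 2) * (k + 2) ≤ (N + 1) * (N + 1) := Nat.mul_le_mul (by omega) (by omega)
      _ = 1 * (N + 1) ^ 2 := by ring
      _ ≤ 4 * (N + 1) ^ 3 := by gcongr <;> omega
  have best_fst : s.reg 22 ≤ k := (congrArg Prod.fst hbest).trans_le (search_fst_le N f k)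
  have best_snd : s.reg 23 ≤ k + 1 := (congrArg Prod.snd hbest).trans_le
    ((search_snd_le N f k).trans (Nat.succ_le_succ (search_fst_le N f k)))
  refine .cons 9 9 ((run_candidateProg hB h4 ((congrArg Prod.snd hf).trans_le hf_le) (by omega)
    (by omega) (by omega)).mono le_rfl ?_) le_rfl
  rintro s₁ ⟨mem₁, reg₁, candidate, num_le⟩
  rw [hf] at candidate
  have h20₁ : s₁.reg 20 = k + 1 := (reg₁ 20 (by norm_num)).trans h20
  have hbest₁ : s₁.pair 22 = search N f k := by
    rw [← hbest, State.pair, State.pair, reg₁ 22 (by norm_num), reg₁ 23 (by norm_num)]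
  refine .cons 6 3 ((run_updateProg ((reg₁ 0 (by norm_num)).trans h0) (by omega) num_le
    candidate).mono le_rfl ?_) le_rfl
  rintro s₂ ⟨mem₂, reg₂, best₂⟩
  rw [reg₁ 3 (by norm_num), h3, h20₁, hbest₁] at best₂
  have h20₂ : s₂.reg 20 = k + 1 := (reg₂ 20 (by norm_num)).trans h20₁
  have h4₂ : s₂.reg 4 = 1 := by rw [reg₂ 4 (by norm_num), reg₁ 4 (by norm_num), h4]
  refine .cons_op (k + 2) (by simp [BinOp.eval, h20₂, h4₂]) (by omega) ?_
  refine .cons_op ((k + 2) * (k + 2)) (by simp [BinOp.eval]) (sq_le.trans hB) ?_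
  refine .nil ⟨mem₂.trans mem₁, ?_, by simp, by simp, by simpa [State.pair, search] using best₂⟩
  simpa using (reg₁.mono (by norm_num)).trans (reg₂.mono (by norm_num))

theorem run_searchProg {k : ℕ} (hB : 4 * (N + 1) ^ 3 ≤ B) (h0 : s.reg 0 = 0) (h3 : s.reg 3 = N)
    (h4 : s.reg 4 = 1) (hf : s.pair 10 = enum N k) :
    Run B searchProg s (19 * Nat.sqrt (N - 1) + 8) fun s' =>
      s'.mem = s.mem ∧ EqBelow 10 s s' ∧ s'.reg 16 = s.reg 16 ∧ s'.pair 10 = enum N (k + 1) := by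
  have le_cube : N + 1 ≤ (N + 1) ^ 3 := Nat.le_self_pow (by norm_num) _
  have fst_le := enum_fst_le N (k + 1)
  have snd_le := enum_snd_le N (k + 1)
  refine .cons_const (by omega) ?_
  refine .cons_const (by omega) ?_
  refine .cons_const (by omega) ?_
  refine .cons_const (by omega) ?_
  refine .cons (Nat.sqrt (N - 1) * (18 + 1) + 1) 3 ((Run.for_loop (fun l s' =>
      s'.mem = s.mem ∧ EqBelow 20 s s' ∧ s'.reg 20 = l + 1 ∧ s'.reg 21 = (l + 1) * (l + 1) ∧
      s'.pair 22 = search N (enum N k) l) _ 18 ?_ ?_ ?_).mono le_rfl ?_) (by omega)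
  · rintro l - s' ⟨-, reg, -, h21, -⟩
    rw [h21, reg 3 (by norm_num), h3, ← Nat.add_one_le_iff (m := Nat.sqrt _), Nat.le_sqrt]
    have : 0 < (l + 1) * (l + 1) := by positivity
    omega
  · rintro l hl s' ⟨mem, reg, h20, -, best⟩
    have hlN : l < N := hl.trans_le ((Nat.sqrt_le_self _).trans N.pred_le)
    have hf' : s'.pair 10 = enum N k := by
      rw [← hf, State.pair, State.pair, reg 10 (by norm_num), reg 11 (by norm_num)]
    refine (run_searchBody hB hlN ((reg 0 (by norm_num)).trans h0)
      ((reg 3 (by norm_num)).trans h3) ((reg 4 (by norm_num)).trans h4) hf' (enum_snd_le N k) h20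
      best).mono le_rfl ?_
    rintro s'' ⟨mem', reg', post⟩
    exact ⟨mem'.trans mem, reg.trans reg', post⟩
  · exact ⟨rfl, by simp, by simp, by simp, by simp [State.pair, search]⟩
  · rintro s' ⟨mem, reg, -, -, best⟩
    have h0' : s'.reg 0 = 0 := (reg 0 (by norm_num)).trans h0
    have fst_eq : s'.reg 22 = (enum N (k + 1)).1 := congrArg Prod.fst best
    have snd_eq : s'.reg 23 = (enum N (k + 1)).2 := congrArg Prod.snd best
    refine .cons_op (enum N (k + 1)).1 (by simp [BinOp.eval, fst_eq, h0']) (by omega) ?_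
    refine .cons_op (enum N (k + 1)).2 (by simp [BinOp.eval, snd_eq, h0']) (by omega) ?_
    refine .nil ⟨mem, ?_, by simp [reg 16], by simp [State.pair]⟩
    simpa using reg.mono (by norm_num)

end RAM

/-! ### Preorder traversal with a stack -/

namespace Drawing

open RootedTree

variable {V : Type u} {G : SimpleGraph V} {r : V} {ch : V → List V}

theorem IsChildLists.mem_iff (hG : G.IsTree) (hch : IsChildLists G r ch) {v w : V} :
    w ∈ ch v ↔ w ≠ r ∧ parent G r w = v := by
  rw [(hch v).2]
  constructor
  · intro h
    refine ⟨?_, parent_eq hG h⟩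
    rintro rfl
    exact not_isChild_root v h
  · rintro ⟨hw, rfl⟩
    exact isChild_parent hG hw

variable [Fintype V]

/-- The leaves below the vertices in the list are numbered consecutively from `k` on. -/
def LeavesFrom (G : SimpleGraph V) (r : V) (ch : V → List V) : ℕ → List V → Prop
  | _, [] => True
  | k, v :: l => firstLeaf G r ch v = k ∧ LeavesFrom G r ch (k + leaves G r v) l

theorem LeavesFrom.append {k : ℕ} {l l' : List V} (h : LeavesFrom G r ch k l)
    (h' : LeavesFrom G r ch (k + (l.map (leaves G r)).sum) l') :
    LeavesFrom G r ch k (l ++ l') := by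
  induction l generalizing k with
  | nil => exact h'
  | cons v l ih =>
    rw [List.map_cons, List.sum_cons, ← add_assoc] at h'
    exact ⟨h.1, ih h.2 h'⟩

theorem leavesFrom_children (hG : G.IsTree) (hch : IsChildLists G r ch) (v : V) :
    LeavesFrom G r ch (firstLeaf G r ch v) (ch v) := by
  have suffix (l₁ l₂ : List V) (h : ch v = l₁ ++ l₂) :
      LeavesFrom G r ch (firstLeaf G r ch v + (l₁.map (leaves G r)).sum) l₂ := by
    induction l₂ generalizing l₁ with
    | nil => trivial
    | cons c l₂ ih =>
      refine ⟨firstLeaf_child hG hch h, ?_⟩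
      simpa [add_assoc] using ih (l₁ ++ [c]) (by simp [h])
  exact suffix [] (ch v) rfl

/-- A state of the preorder traversal that visits the top `v` of a stack and replaces it by
`ch v`: `W` is the set of visited vertices, `S` is the stack, with its top first, and `k` is the
number of visited leaves. -/
structure IsTraversal (G : SimpleGraph V) (r : V) (ch : V → List V) (W : Finset V) (S : List V)
    (k : ℕ) : Prop where
  nodup : S.Nodup
  notMem_visited : ∀ v ∈ S, v ∉ W
  mem_iff : ∀ v, v ∈ W ∨ v ∈ S ↔ v = r ∨ parent G r v ∈ W
  leavesFrom : LeavesFrom G r ch k S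

namespace IsTraversal

variable {W : Finset V} {S : List V} {k : ℕ} {v : V}

theorem init (G : SimpleGraph V) (r : V) (ch : V → List V) : IsTraversal G r ch ∅ [r] 0 where
  nodup := List.nodup_singleton r
  notMem_visited _ _ := Finset.notMem_empty _
  mem_iff v := by simp
  leavesFrom := ⟨firstLeaf_root, trivial⟩

theorem firstLeaf_eq (h : IsTraversal G r ch W (v :: S) k) : firstLeaf G r ch v = k :=
  h.leavesFrom.1

theorem parent_mem (h : IsTraversal G r ch W (v :: S) k) (hv : v ≠ r) : parent G r v ∈ W :=
  ((h.mem_iff v).1 (.inr List.mem_cons_self)).resolve_left hv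

theorem disjoint_children (hG : G.IsTree) (hch : IsChildLists G r ch)
    (h : IsTraversal G r ch W (v :: S) k) {u : V} (hu : u ∈ ch v) : ¬ (u ∈ W ∨ u ∈ v :: S) := by
  obtain ⟨u_ne, parent_u⟩ := (hch.mem_iff hG).1 hu
  rw [h.mem_iff, not_or, parent_u]
  exact ⟨u_ne, h.notMem_visited v List.mem_cons_self⟩

theorem visit [DecidableEq V] (hG : G.IsTree) (hch : IsChildLists G r ch)
    (h : IsTraversal G r ch W (v :: S) k) :
    IsTraversal G r ch (insert v W) (ch v ++ S) (if ch v = [] then k + 1 else k) where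
  nodup := by
    refine (hch v).1.append h.nodup.of_cons fun u hu hu' => ?_
    exact h.disjoint_children hG hch hu (.inr (List.mem_cons_of_mem v hu'))
  notMem_visited u hu_mem hu' := by
    obtain hu | hu := List.mem_append.1 hu_mem
    · refine h.disjoint_children hG hch hu ?_
      rw [List.mem_cons]
      exact (Finset.mem_insert.1 hu').elim (fun e => .inr (.inl e)) .inl
    · obtain rfl | hu' := Finset.mem_insert.1 hu'
      · exact (List.nodup_cons.1 h.nodup).1 hu
      · exact h.notMem_visited u (List.mem_cons_of_mem v hu) hu'
  mem_iff u := by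
    have := h.mem_iff u
    simp only [Finset.mem_insert, List.mem_append, List.mem_cons, hch.mem_iff hG] at this ⊢
    tauto
  leavesFrom := by
    obtain ⟨rfl, later⟩ := h.leavesFrom
    split_ifs with hv
    · rwa [hv, List.nil_append, ← leaves_of_isLeaf (hch.eq_nil_iff_isLeaf.1 hv)]
    · rw [hch.eq_nil_iff_isLeaf] at hv
      exact (leavesFrom_children hG hch v).append (leaves_eq_sum hG hch hv ▸ later)

theorem mem_of_nil (hG : G.IsTree) (h : IsTraversal G r ch W [] k) (v : V) : v ∈ W := by
  have mem_iff (v : V) : v ∈ W ↔ v = r ∨ parent G r v ∈ W := by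
    simpa using h.mem_iff v
  induction isAncestor_root (r := r) hG v with
  | refl => exact (mem_iff r).2 (.inl rfl)
  | tail _ hc ih => exact (mem_iff _).2 (.inr (parent_eq hG hc ▸ ih))

end IsTraversal

end Drawing

/-! ### The program for the traversal -/

namespace RAM

open Fractions RootedTree Drawing

variable {B n N : ℕ} {s : State}

/-- The registers below 10 hold the constants of the traversal: the size, the bound on the
coordinates of the vectors, and the addresses of the tables, the stack and the adjacency lists. -/
structure Consts (n N : ℕ) (s : State) : Prop where
  zero : s.reg 0 = 0
  size : s.reg 1 = n
  bound : s.reg 3 = N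
  one : s.reg 4 = 1
  parents : s.reg 5 = 4 * n
  abscissas : s.reg 6 = 5 * n
  ordinates : s.reg 7 = 6 * n
  stack : s.reg 8 = 7 * n
  lists : s.reg 9 = n + 3

theorem Consts.of_eqBelow {m : ℕ} {s' : State} (h : Consts n N s) (hs : EqBelow m s s')
    (hm : 10 ≤ m) : Consts n N s' := by
  have reg_eq (i : ℕ) (hi : i < 10) : s'.reg i = s.reg i := hs i (hi.trans_le hm)
  constructor <;> rw [reg_eq _ (by norm_num)]
  exacts [h.zero, h.size, h.bound, h.one, h.parents, h.abscissas, h.ordinates, h.stack, h.lists]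

/-- Take the vertex `R 12` from the stack and load its parent `R 13`. -/
def popProg : Prog := block [
  .op .sub 16 16 4, .op .add 14 16 0, .op .add 18 8 16, .load 12 18, .op .add 18 5 12, .load 13 18]

/-- In the table at address `R j`, the entry of the vertex becomes the sum of the entry of its
parent and `R 18`. -/
def placeProg (j : ℕ) : Prog := block [
  .op .add 19 j 13, .load 20 19, .op .add 18 18 20, .op .add 19 j 12, .store 19 18]

/-- Load the indices at which the adjacency list of the vertex starts and ends. -/
def lookupProg : Prog := block [
  .const 18 2, .op .add 18 18 12, .load 17 18, .op .add 18 18 4, .load 15 18]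

/-- Place the vertex at the position of its parent plus the Pythagorean vector of the fraction in
`R 10` and `R 11`. -/
def positionProg : Prog := block [
  .op .mul 18 10 10, .op .mul 19 11 11, .op .sub 18 18 19, placeProg 6,
  .op .mul 18 10 11, .op .add 18 18 18, placeProg 7]

/-- Take a vertex from the stack, place it, and look up its adjacency list. -/
def visitProg : Prog := block [popProg, positionProg, lookupProg]

/-- Push the vertex `R 18` on the stack, as a child of the vertex `R 12`. -/
def pushProg : Prog := block [
  .op .add 19 5 18, .store 19 12, .op .add 19 8 16, .store 19 18, .op .add 16 16 4]

/-- Push the neighbor at index `R 17` of the adjacency lists if it is not the parent. -/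
def pushBody : Prog := block [
  .op .add 18 9 17, .load 18 18, ifNe 18 13 pushProg, .op .add 17 17 4]

/-- Visit a vertex, push its children, and advance to the next fraction if there are none. -/
def traverseBody : Prog := block [visitProg, .loop 17 15 pushBody, .cond 14 16 .skip searchProg]

/-- The entries of vertex `v` in the tables of abscissas and ordinates. -/
def State.coordinates (s : State) (n v : ℕ) : ℕ × ℕ := (s.mem (5 * n + v), s.mem (6 * n + v))

section Subprograms

variable {v p : Fin n}

theorem run_popProg {h : ℕ} (hB : 8 * n ≤ B) (hs : Consts n N s) (hh : h < n)
    (height : s.reg 16 = h + 1) (top : s.mem (7 * n + h) = v) (parent : s.mem (4 * n + v) = p) :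
    Run B popProg s 7 fun s' => s'.mem = s.mem ∧ EqBelow 12 s s' ∧
      s'.reg 12 = v ∧ s'.reg 13 = p ∧ s'.reg 14 = h ∧ s'.reg 16 = h := by
  refine .cons_op h (by simp [BinOp.eval, height, hs.one]) (by omega) ?_
  refine .cons_op h (by simp [BinOp.eval, hs.zero]) (by omega) ?_
  refine .cons_op (7 * n + h) (by simp [BinOp.eval, hs.stack]) (by omega) ?_
  refine .cons_load v (by simpa using top) (by omega) ?_
  refine .cons_op (4 * n + v) (by simp [BinOp.eval, hs.parents]) (by omega) ?_
  refine .cons_load p (by simpa using parent) (by omega) ?_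
  exact .nil ⟨rfl, by simp, by simp, by simp, by simp, by simp⟩

theorem run_placeProg {j b x : ℕ} (hj : j < 18) (vertex : s.reg 12 = v) (parent : s.reg 13 = p)
    (table : s.reg j = b) (hb : b + n ≤ B) (sum : s.mem (b + p) + s.reg 18 = x) (hx : x ≤ B) :
    Run B (placeProg j) s 6 fun s' =>
      s'.mem = Function.update s.mem (b + v) x ∧ EqBelow 18 s s' := by
  have h18 : j ≠ 18 := hj.ne
  have h19 : j ≠ 19 := by omega
  have h20 : j ≠ 20 := by omega
  refine .cons_op (b + p) (by simp [BinOp.eval, parent, table]) (by omega) ?_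
  refine .cons_load (s.mem (b + p)) (by simp) (by omega) ?_
  refine .cons_op x (by simp [BinOp.eval, ← sum, add_comm]) hx ?_
  refine .cons_op (b + v) (by simp [BinOp.eval, vertex, table, h18, h19, h20]) (by omega) ?_
  refine .cons_store (b + v) x (by simp) (by simp) hx ?_
  exact .nil ⟨rfl, by simp⟩

theorem run_positionProg {m : ℕ} {f q : ℕ × ℕ} (hB : 8 * n ≤ B) (hs : Consts n N s)
    (hf : s.pair 10 = f) (h₁ : f.1 ≤ m) (h₂ : f.2 ≤ m) (hm : 2 * m ^ 2 ≤ B)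
    (vertex : s.reg 12 = v) (parent : s.reg 13 = p)
    (sum : s.coordinates n p + pythagorean f = q) (hq : q ≤ (B, B)) :
    Run B positionProg s 18 fun s' =>
      s'.mem = Function.update (Function.update s.mem (5 * n + v) q.1) (6 * n + v) q.2 ∧
      EqBelow 18 s s' := by
  subst hf sum
  have fst_sq_le := Nat.mul_le_mul h₁ h₁
  have snd_sq_le := Nat.mul_le_mul h₂ h₂
  have mul_le := Nat.mul_le_mul h₁ h₂
  rw [sq] at hm
  refine .cons_op (s.reg 10 * s.reg 10) (by simp [BinOp.eval]) (fst_sq_le.trans (by omega)) ?_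
  refine .cons_op (s.reg 11 * s.reg 11) (by simp [BinOp.eval]) (snd_sq_le.trans (by omega)) ?_
  refine .cons_op (pythagorean (s.pair 10)).1 (by simp [BinOp.eval, pythagorean, State.pair])
    ((Nat.le_add_left ..).trans hq.1) ?_
  refine .cons 6 9 ((run_placeProg (b := 5 * n) (by norm_num) (by simpa using vertex)
    (by simpa using parent) (by simpa using hs.abscissas) (by omega) (by simp; rfl)
    hq.1).mono le_rfl ?_) le_rfl
  rintro s₁ ⟨mem, reg⟩
  simp only [setReg_eqBelow_iff, le_refl, Nat.reduceLeDiff] at reg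
  refine .cons_op (s.reg 10 * s.reg 11) (by simp [BinOp.eval, reg 10, reg 11])
    (mul_le.trans (by omega)) ?_
  refine .cons_op (pythagorean (s.pair 10)).2
    (by simp [BinOp.eval, pythagorean, State.pair, two_mul]) ((Nat.le_add_left ..).trans hq.2) ?_
  refine .cons 6 1 ((run_placeProg (v := v) (p := p) (b := 6 * n) (by norm_num)
    (by simp [reg 12, vertex]) (by simp [reg 13, parent]) (by simp [reg 7, hs.ordinates])
    (by omega) ?_ hq.2).mono le_rfl ?_) le_rfl
  · rw [State.mem_setReg, State.mem_setReg, mem, Function.update_of_ne (by omega)]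
    simp [State.coordinates]
  · rintro s₂ ⟨mem', reg'⟩
    simp only [setReg_eqBelow_iff, le_refl] at reg'
    exact .nil ⟨by rw [mem', State.mem_setReg, State.mem_setReg, mem]; rfl, reg.trans reg'⟩

theorem run_lookupProg {x y : ℕ} (hB : 8 * n ≤ B) (one : s.reg 4 = 1) (vertex : s.reg 12 = v)
    (first : s.mem (2 + v) = x) (last : s.mem (2 + (v + 1)) = y) (hx : x ≤ B) (hy : y ≤ B) :
    Run B lookupProg s 6 fun s' => s'.mem = s.mem ∧ EqBelow 15 s s' ∧
      s'.reg 15 = y ∧ s'.reg 16 = s.reg 16 ∧ s'.reg 17 = x := by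
  refine .cons_const (by omega) ?_
  refine .cons_op (2 + v) (by simp [BinOp.eval, vertex]) (by omega) ?_
  refine .cons_load x (by simpa using first) hx ?_
  refine .cons_op (2 + (v + 1)) (by simp [BinOp.eval, one, add_assoc]) (by omega) ?_
  refine .cons_load y (by simpa using last) hy ?_
  exact .nil ⟨rfl, by simp, by simp, by simp, by simp⟩

theorem run_pushProg {h : ℕ} {w : Fin n} (hB : 8 * n ≤ B) (hs : Consts n N s) (hh : h < n)
    (height : s.reg 16 = h) (vertex : s.reg 12 = v) (child : s.reg 18 = w) :
    Run B pushProg s 6 fun s' =>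
      s'.mem = Function.update (Function.update s.mem (4 * n + w) v) (7 * n + h) w ∧
      EqBelow 16 s s' ∧ s'.reg 16 = h + 1 ∧ s'.reg 17 = s.reg 17 := by
  refine .cons_op (4 * n + w) (by simp [BinOp.eval, hs.parents, child]) (by omega) ?_
  refine .cons_store (4 * n + w) v (by simp) (by simp [vertex]) (by omega) ?_
  refine .cons_op (7 * n + h) (by simp [BinOp.eval, hs.stack, height]) (by omega) ?_
  refine .cons_store (7 * n + h) w (by simp) (by simp [child]) (by omega) ?_
  refine .cons_op (h + 1) (by simp [BinOp.eval, height, hs.one]) (by omega) ?_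
  exact .nil ⟨rfl, by simp, by simp, by simp⟩

end Subprograms

end RAM

/-! ### The state of the traversal -/

namespace RAM

open Fractions RootedTree Drawing

variable {B n N : ℕ} {G : SimpleGraph (Fin n)} {r : Fin n} {adj : Fin n → List (Fin n)}

/-- The neighbors of `v` in the list that are not its parent, in the order in which pushing them
one after the other puts them on a stack. -/
noncomputable def pushOrder (G : SimpleGraph (Fin n)) (r v : Fin n) (l : List (Fin n)) :
    List (Fin n) :=
  (l.filter (· ≠ parent G r v)).reverse

theorem pushOrder_take_succ (G : SimpleGraph (Fin n)) (r v : Fin n) {l : List (Fin n)} {i : ℕ}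
    (hi : i < l.length) :
    pushOrder G r v (l.take (i + 1)) =
      if l[i] = parent G r v then pushOrder G r v (l.take i)
        else l[i] :: pushOrder G r v (l.take i) := by
  rw [pushOrder, pushOrder, List.take_succ_eq_append_getElem hi, List.filter_append]
  split_ifs with h <;> simp [-List.take_append_getElem, h]

/-- The children of the vertices in the order in which the traversal visits them. -/
noncomputable def childLists (G : SimpleGraph (Fin n)) (r : Fin n) (adj : Fin n → List (Fin n))
    (v : Fin n) : List (Fin n) :=
  pushOrder G r v (adj v)

theorem isChildLists_childLists (hG : G.IsTree) (hadj : IsAdjLists G adj) :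
    IsChildLists G r (childLists G r adj) := by
  refine fun v => ⟨List.nodup_reverse.2 ((hadj v).1.filter _), fun w => ?_⟩
  rw [isChild_iff_adj_and_ne_parent hG, childLists, pushOrder, List.mem_reverse, List.mem_filter,
    (hadj v).2, decide_eq_true_iff]

theorem length_pushOrder_take_le (v : Fin n) (i : ℕ) :
    (pushOrder G r v ((adj v).take i)).length ≤ (childLists G r adj v).length := by
  rw [childLists, pushOrder, pushOrder, List.length_reverse, List.length_reverse]
  exact ((List.take_sublist i (adj v)).filter _).length_le

theorem offset_le (hG : G.IsTree) (hadj : IsAdjLists G adj) {k : ℕ} (hk : k ≤ n) :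
    offset adj k + 2 ≤ 2 * n := by
  rw [← hadj.sum_length_add_two hG, ← offset_card]
  exact Nat.add_le_add_right (offset_mono adj hk) 2

theorem position_le (hG : G.IsTree) (hN : N + 1 ≤ 8 * n) (ch : Fin n → List (Fin n))
    (v : Fin n) : position G r ch N v ≤ (128 * n ^ 3, 128 * n ^ 3) := by
  have direction_le (u : Fin n) :
      direction N (firstLeaf G r ch u) ≤ (2 * (8 * n) ^ 2, 2 * (8 * n) ^ 2) :=
    pythagorean_le _ ((enum_fst_le N _).trans hN) ((enum_snd_le N _).trans hN)
  have dist_lt : G.dist r v < n := (dist_lt_card hG v).trans_eq (Fintype.card_fin n)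
  calc position G r ch N v
      ≤ direction N (firstLeaf G r ch r) + G.dist r v • (2 * (8 * n) ^ 2, 2 * (8 * n) ^ 2) :=
        ancestorSum_le hG direction_le v
    _ ≤ (G.dist r v + 1) • (2 * (8 * n) ^ 2, 2 * (8 * n) ^ 2) := by
        rw [succ_nsmul']
        exact add_le_add_left (direction_le r) _
    _ ≤ n • (2 * (8 * n) ^ 2, 2 * (8 * n) ^ 2) := nsmul_le_nsmul_left zero_le dist_lt
    _ = (128 * n ^ 3, 128 * n ^ 3) := by
        rw [Prod.smul_mk, smul_eq_mul]
        ring_nf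

/-- The memory holds the stack from address `base` on, with its top first in the list. -/
def StackAt (mem : ℕ → ℕ) (base : ℕ) : List (Fin n) → Prop
  | [] => True
  | v :: S => mem (base + S.length) = v ∧ StackAt mem base S

theorem StackAt.update {mem : ℕ → ℕ} {base a x : ℕ} {S : List (Fin n)} (h : StackAt mem base S)
    (ha : a < base ∨ base + S.length ≤ a) : StackAt (Function.update mem a x) base S := by
  induction S with
  | nil => trivial
  | cons v S ih =>
    rw [List.length_cons] at ha
    refine ⟨?_, ih h.2 (by omega)⟩
    rw [Function.update_of_ne (by omega), h.1]

/-- The machine has visited the vertices in `W` and `k` leaves among them, and the stack is `S`. -/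
structure Represents (G : SimpleGraph (Fin n)) (r : Fin n) (adj : Fin n → List (Fin n)) (N : ℕ)
    (W : Finset (Fin n)) (S : List (Fin n)) (k : ℕ) (s : State) : Prop where
  consts : Consts n N s
  input : ∀ a < 4 * n, s.mem a = (encode adj r).getD a 0
  fraction : s.pair 10 = enum N k
  height : s.reg 16 = S.length
  stack : StackAt s.mem (7 * n) S
  parents : ∀ v ∈ S, s.mem (4 * n + v) = (parent G r v).val
  visited : ∀ v ∈ W, s.coordinates n v = position G r (childLists G r adj) N v
  root : r ∉ W → s.coordinates n r = 0

namespace Represents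

variable {W : Finset (Fin n)} {S : List (Fin n)} {k : ℕ} {s s' : State} {v w : Fin n}

theorem coordinates_parent_add (hG : G.IsTree)
    (ht : IsTraversal G r (childLists G r adj) W (v :: S) k)
    (h : Represents G r adj N W (v :: S) k s) :
    s.coordinates n (parent G r v).val + direction N k = position G r (childLists G r adj) N v := by
  rw [← ht.firstLeaf_eq]
  obtain rfl | hv := eq_or_ne v r
  · rw [parent_root, h.root (ht.notMem_visited v List.mem_cons_self), zero_add, position,
      ancestorSum_root]
  · rw [h.visited _ (ht.parent_mem hv), position, position,
      ancestorSum_child hG (isChild_parent hG hv)]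

theorem of_mem_eq {k' : ℕ} (h : Represents G r adj N W S k s) (hmem : s'.mem = s.mem)
    (hreg : EqBelow 10 s s') (height : s'.reg 16 = s.reg 16) (fraction : s'.pair 10 = enum N k') :
    Represents G r adj N W S k' s' where
  consts := h.consts.of_eqBelow hreg le_rfl
  input := hmem ▸ h.input
  fraction := fraction
  height := height.trans h.height
  stack := hmem ▸ h.stack
  parents := hmem ▸ h.parents
  visited v hv := by rw [State.coordinates, hmem, ← h.visited v hv, State.coordinates]
  root hr := by rw [State.coordinates, hmem, ← h.root hr, State.coordinates]

theorem visit (h : Represents G r adj N W (v :: S) k s)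
    (hmem : s'.mem = Function.update (Function.update s.mem
      (5 * n + v) (position G r (childLists G r adj) N v).1)
      (6 * n + v) (position G r (childLists G r adj) N v).2)
    (hreg : EqBelow 12 s s') (height : s'.reg 16 = S.length) :
    Represents G r adj N (insert v W) S k s' := by
  have coordinates_of_ne {u : Fin n} (hu : u ≠ v) : s'.coordinates n u = s.coordinates n u := by
    have := Fin.val_ne_of_ne hu
    rw [State.coordinates, hmem, Function.update_of_ne (by omega),
      Function.update_of_ne (by omega), Function.update_of_ne (by omega),
      Function.update_of_ne (by omega), State.coordinates]
  have mem_eq {a : ℕ} (ha : a < 5 * n) : s'.mem a = s.mem a := by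
    rw [hmem, Function.update_of_ne (by omega), Function.update_of_ne (by omega)]
  refine ⟨h.consts.of_eqBelow hreg (by norm_num), fun a ha => ?_, ?_, height, ?_, fun u hu => ?_,
    fun u hu => ?_, fun hr => ?_⟩
  · rw [mem_eq (by omega), h.input a ha]
  · rw [← h.fraction, State.pair, State.pair, hreg 10 (by norm_num), hreg 11 (by norm_num)]
  · rw [hmem]
    exact (h.stack.2.update (by omega)).update (by omega)
  · rw [mem_eq (by omega), h.parents u (List.mem_cons_of_mem v hu)]
  · obtain rfl | hne := eq_or_ne u v
    · rw [State.coordinates, hmem, Function.update_self, Function.update_of_ne (by omega),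
        Function.update_self]
    · rw [coordinates_of_ne hne, h.visited u (Finset.mem_of_mem_insert_of_ne hu hne)]
  · rw [Finset.mem_insert, not_or] at hr
    rw [coordinates_of_ne hr.1, h.root hr.2]

theorem push (h : Represents G r adj N W S k s) (hw : parent G r w = v)
    (hmem : s'.mem = Function.update (Function.update s.mem (4 * n + w) v)
      (7 * n + S.length) w)
    (hreg : EqBelow 12 s s') (height : s'.reg 16 = S.length + 1) :
    Represents G r adj N W (w :: S) k s' := by
  have coordinates_eq (u : Fin n) : s'.coordinates n u = s.coordinates n u := by
    rw [State.coordinates, hmem, Function.update_of_ne (by omega),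
      Function.update_of_ne (by omega), Function.update_of_ne (by omega),
      Function.update_of_ne (by omega), State.coordinates]
  refine ⟨h.consts.of_eqBelow hreg (by norm_num), fun a ha => ?_, ?_, height, ⟨?_, ?_⟩,
    fun u hu => ?_, fun u hu => ?_, fun hr => ?_⟩
  · rw [hmem, Function.update_of_ne (by omega), Function.update_of_ne (by omega), h.input a ha]
  · rw [← h.fraction, State.pair, State.pair, hreg 10 (by norm_num), hreg 11 (by norm_num)]
  · rw [hmem, Function.update_self]
  · rw [hmem]
    exact (h.stack.update (by omega)).update (by omega)
  · rw [hmem, Function.update_of_ne (by omega)]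
    obtain rfl | hne := eq_or_ne u w
    · rw [Function.update_self, hw]
    · have := Fin.val_ne_of_ne hne
      rw [Function.update_of_ne (by omega), h.parents u (List.mem_of_ne_of_mem hne hu)]
  · rw [coordinates_eq, h.visited u hu]
  · rw [coordinates_eq, h.root hr]

end Represents

/-- The machine has visited `v` and pushed those children of `v` that are among the first `i`
entries of its adjacency list, on the stack `S`. -/
structure Visiting (G : SimpleGraph (Fin n)) (r : Fin n) (adj : Fin n → List (Fin n)) (N : ℕ)
    (W : Finset (Fin n)) (S : List (Fin n)) (k : ℕ) (v : Fin n) (i : ℕ) (s : State) : Prop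
    extends Represents G r adj N W (pushOrder G r v ((adj v).take i) ++ S) k s where
  vertex : s.reg 12 = v
  parent : s.reg 13 = (parent G r v).val
  oldHeight : s.reg 14 = S.length
  last : s.reg 15 = offset adj (v + 1)
  index : s.reg 17 = offset adj v + i

theorem four_mul_cube_le (hN : N + 1 ≤ 8 * n) (hB : 2048 * n ^ 3 ≤ B) : 4 * (N + 1) ^ 3 ≤ B :=
  calc 4 * (N + 1) ^ 3 ≤ 4 * (8 * n) ^ 3 := by gcongr
    _ = 2048 * n ^ 3 := by ring
    _ ≤ B := hB

section Visit

variable {W : Finset (Fin n)} {S : List (Fin n)} {k i : ℕ} {s : State} {v : Fin n}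

theorem Visiting.succ {s' : State} (h : Visiting G r adj N W S k v i s) (hs : EqBelow 16 s s')
    (index : s'.reg 17 = offset adj v + (i + 1))
    (h' : Represents G r adj N W (pushOrder G r v ((adj v).take (i + 1)) ++ S) k s') :
    Visiting G r adj N W S k v (i + 1) s' where
  __ := h'
  vertex := (hs 12 (by norm_num)).trans h.vertex
  parent := (hs 13 (by norm_num)).trans h.parent
  oldHeight := (hs 14 (by norm_num)).trans h.oldHeight
  last := (hs 15 (by norm_num)).trans h.last
  index := index

theorem run_visitProg (hG : G.IsTree) (hadj : IsAdjLists G adj) (hN : N + 1 ≤ 8 * n)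
    (hB : 2048 * n ^ 3 ≤ B) (ht : IsTraversal G r (childLists G r adj) W (v :: S) k)
    (h : Represents G r adj N W (v :: S) k s) :
    Run B visitProg s 32 (Visiting G r adj N (insert v W) S k v 0) := by
  have hn : 0 < n := v.pos
  have n_le : n ≤ n ^ 3 := Nat.le_self_pow (by norm_num) n
  have sq_le : n ^ 2 ≤ n ^ 3 := Nat.pow_le_pow_right hn (by norm_num)
  have length_lt : S.length < n := by simpa using ht.nodup.length_le_card
  have offset_le_word (m : ℕ) (hm : m ≤ n) : offset adj m ≤ B := by
    have := offset_le hG hadj hm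
    omega
  have position_le_word : position G r (childLists G r adj) N v ≤ (B, B) :=
    (position_le hG hN _ v).trans ⟨by dsimp only; omega, by dsimp only; omega⟩
  refine .cons 7 25 ((run_popProg (by omega) h.consts length_lt h.height h.stack.1
    (h.parents v List.mem_cons_self)).mono le_rfl ?_) le_rfl
  rintro s₁ ⟨mem₁, reg₁, vertex₁, parent₁, oldHeight₁, height₁⟩
  refine .cons 18 7 ((run_positionProg (by omega) (h.consts.of_eqBelow reg₁ (by norm_num))
    (h.fraction ▸ congrArg₂ Prod.mk (reg₁ 10 (by norm_num)) (reg₁ 11 (by norm_num)))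
    ((enum_fst_le N k).trans hN) ((enum_snd_le N k).trans hN) (by rw [mul_pow]; omega)
    vertex₁ parent₁ (by rw [State.coordinates, mem₁]; exact h.coordinates_parent_add hG ht)
    position_le_word).mono le_rfl ?_) le_rfl
  rintro s₂ ⟨mem₂, reg₂⟩
  have mem_eq {a : ℕ} (ha : a < 4 * n) : s₂.mem a = (encode adj r).getD a 0 := by
    rw [mem₂, Function.update_of_ne (by omega), Function.update_of_ne (by omega), mem₁,
      h.input a ha]
  have reg₁₂ : EqBelow 12 s s₂ := reg₁.trans (reg₂.mono (by norm_num))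
  refine .cons 6 1 ((run_lookupProg (by omega) ((reg₁₂ 4 (by norm_num)).trans h.consts.one)
    ((reg₂ 12 (by norm_num)).trans vertex₁)
    ((mem_eq (by omega)).trans (encode_offset adj r v.is_lt.le))
    ((mem_eq (by omega)).trans (encode_offset adj r v.is_lt))
    (offset_le_word _ v.is_lt.le) (offset_le_word _ v.is_lt)).mono le_rfl ?_) le_rfl
  rintro s₃ ⟨mem₃, reg₃, last₃, height₃, index₃⟩
  refine .nil ⟨h.visit (by rw [mem₃, mem₂, mem₁]) (reg₁₂.trans (reg₃.mono (by norm_num)))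
    ?_, ?_, ?_, ?_, last₃, index₃⟩
  · rw [height₃, reg₂ 16 (by norm_num), height₁]
  · rw [reg₃ 12 (by norm_num), reg₂ 12 (by norm_num), vertex₁]
  · rw [reg₃ 13 (by norm_num), reg₂ 13 (by norm_num), parent₁]
  · rw [reg₃ 14 (by norm_num), reg₂ 14 (by norm_num), oldHeight₁]

theorem Represents.run_pushProg {w : Fin n} (hB : 8 * n ≤ B) (h : Represents G r adj N W S k s)
    (length_lt : S.length < n) (hw : Drawing.parent G r w = v) (vertex : s.reg 12 = v)
    (child : s.reg 18 = w) :
    Run B pushProg s 6 fun s' => Represents G r adj N W (w :: S) k s' ∧ EqBelow 16 s s' ∧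
      s'.reg 17 = s.reg 17 := by
  refine (RAM.run_pushProg hB h.consts length_lt h.height vertex child).mono le_rfl ?_
  rintro s' ⟨mem, reg, height, index⟩
  exact ⟨h.push hw mem (reg.mono (by norm_num)) height, reg, index⟩

theorem run_pushBody (hG : G.IsTree) (hadj : IsAdjLists G adj) (hB : 2048 * n ^ 3 ≤ B)
    (hi : i < (adj v).length) (hS : (childLists G r adj v ++ S).length ≤ n)
    (h : Visiting G r adj N W S k v i s) :
    Run B pushBody s 12 (Visiting G r adj N W S k v (i + 1)) := by
  have n_le : n ≤ n ^ 3 := Nat.le_self_pow (by norm_num) n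
  have offset_add_lt : offset adj v + i + 2 < 2 * n := by
    have := offset_le hG hadj v.is_lt
    rw [offset_succ] at this
    omega
  set w := (adj v)[i] with hw
  have take_succ := pushOrder_take_succ G r v hi
  rw [← hw] at take_succ
  have advance {s₁ : State} (reg₁ : EqBelow 16 s s₁) (index₁ : s₁.reg 17 = s.reg 17)
      (h₁ : Represents G r adj N W (pushOrder G r v ((adj v).take (i + 1)) ++ S) k s₁) :
      Run B (block [.op .add 17 17 4]) s₁ 2 (Visiting G r adj N W S k v (i + 1)) :=
    .cons_op (offset adj v + i + 1) (by simp [BinOp.eval, index₁, h.index, h₁.consts.one])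
      (by omega) (.nil (h.succ (by simpa using reg₁) (by simp [add_assoc])
        (h₁.of_mem_eq rfl (by simp) (by simp) (by simpa [State.pair] using h₁.fraction))))
  refine .cons_op (n + 3 + (offset adj v + i))
    (by simp [BinOp.eval, h.consts.lists, h.index]) (by omega) ?_
  refine .cons_load w ?_ (by omega) ?_
  · simp only [State.reg_setReg, if_pos, State.mem_setReg]
    rw [h.input _ (by omega), encode_adj adj r v hi]
  have represents₁ : Represents G r adj N W (pushOrder G r v ((adj v).take i) ++ S) k
      ((s.setReg 18 (n + 3 + (offset adj v + i))).setReg 18 w) :=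
    h.of_mem_eq rfl (by simp) (by simp) (by simpa [State.pair] using h.fraction)
  refine .cons 8 2 (.ifNe (by norm_num) (fun hne => ?_) fun heq => ?_) le_rfl
  · simp only [State.reg_setReg, if_pos, Nat.reduceEqDiff, if_false, h.parent] at hne
    replace hne : w ≠ Drawing.parent G r v := fun e => hne (congrArg Fin.val e)
    have parent_w : Drawing.parent G r w = v := parent_eq hG
      ((isChild_iff_adj_and_ne_parent hG).2 ⟨((hadj v).2 w).1 (List.getElem_mem hi), hne⟩)
    have length_le := length_pushOrder_take_le (G := G) (r := r) (adj := adj) v (i + 1)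
    rw [if_neg hne] at take_succ
    rw [take_succ, List.length_cons] at length_le
    rw [List.length_append] at hS
    refine (represents₁.run_pushProg (by omega) (by rw [List.length_append]; omega) parent_w
      h.vertex (by simp)).mono le_rfl ?_
    rintro s₂ ⟨represents₂, reg₂, index₂⟩
    exact advance (by simpa using reg₂) (by simpa using index₂) (take_succ ▸ represents₂)
  · simp only [State.reg_setReg, if_pos, Nat.reduceEqDiff, if_false, h.parent] at heq
    rw [if_pos (Fin.ext heq)] at take_succ
    exact advance (by simp) (by simp) (take_succ ▸ represents₁)

/-- The time in which the machine visits `v`. -/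
noncomputable def visitTime (G : SimpleGraph (Fin n)) (r : Fin n) (adj : Fin n → List (Fin n))
    (N : ℕ) (v : Fin n) : ℕ :=
  43 + 13 * (adj v).length + if childLists G r adj v = [] then 19 * Nat.sqrt (N - 1) else 0

theorem run_traverseBody (hG : G.IsTree) (hadj : IsAdjLists G adj) (hN : N + 1 ≤ 8 * n)
    (hB : 2048 * n ^ 3 ≤ B) (ht : IsTraversal G r (childLists G r adj) W (v :: S) k)
    (h : Represents G r adj N W (v :: S) k s) :
    Run B traverseBody s (visitTime G r adj N v)
      (Represents G r adj N (insert v W) (childLists G r adj v ++ S)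
        (if childLists G r adj v = [] then k + 1 else k)) := by
  have length_le : (childLists G r adj v ++ S).length ≤ n := by
    simpa using (ht.visit hG (isChildLists_childLists hG hadj)).nodup.length_le_card
  set τ := if childLists G r adj v = [] then 19 * Nat.sqrt (N - 1) else 0 with hτ
  refine .cons 32 (11 + 13 * (adj v).length + τ)
    ((run_visitProg hG hadj hN hB ht h).mono le_rfl ?_) (by rw [visitTime]; omega)
  intro s₁ h₁
  refine .cons ((adj v).length * 13 + 1) (10 + τ) ((Run.for_loop
    (Visiting G r adj N (insert v W) S k v) _ 12 ?_ ?_ h₁).mono le_rfl ?_) (by omega)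
  · intro i _ s' h'
    rw [h'.index, h'.last, offset_succ]
    omega
  · exact fun i hi s' h' => run_pushBody hG hadj hB hi length_le h'
  intro s₂ h₂
  have represents₂ : Represents G r adj N (insert v W) (childLists G r adj v ++ S) k s₂ := by
    simpa [childLists] using h₂.toRepresents
  have height_lt_iff : s₂.reg 14 < s₂.reg 16 ↔ childLists G r adj v ≠ [] := by
    rw [h₂.oldHeight, represents₂.height, List.length_append, Nat.lt_add_left_iff_pos,
      List.length_pos_iff]
  refine .cons (8 + τ + 1) 1 (.cond (fun hlt => ?_) fun hge => ?_) (by omega)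
  · rw [if_neg (height_lt_iff.1 hlt)]
    exact .skip (by omega) (.nil represents₂)
  · rw [if_pos (not_not.1 (height_lt_iff.not.1 hge))] at hτ ⊢
    refine (run_searchProg (four_mul_cube_le hN hB) represents₂.consts.zero represents₂.consts.bound
      represents₂.consts.one represents₂.fraction).mono (by omega) ?_
    rintro s₃ ⟨mem, reg, height, fraction⟩
    exact .nil (represents₂.of_mem_eq mem reg height fraction)

theorem run_traverse (hG : G.IsTree) (hadj : IsAdjLists G adj) (hN : N + 1 ≤ 8 * n)
    (hB : 2048 * n ^ 3 ≤ B) (h : Represents G r adj N ∅ [r] 0 s) :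
    Run B (.loop 0 16 traverseBody) s (∑ v, (visitTime G r adj N v + 1) + 1) fun s' =>
      Consts n N s' ∧ ∀ v : Fin n, s'.coordinates n v = position G r (childLists G r adj) N v := by
  refine Run.loop (fun τ s' => ∃ W S k, Represents G r adj N W S k s' ∧
    IsTraversal G r (childLists G r adj) W S k ∧
    τ = ∑ v ∈ Wᶜ, (visitTime G r adj N v + 1) + 1) ?_ ?_
    ⟨∅, [r], 0, h, .init G r _, by rw [Finset.compl_empty]⟩
  · rintro τ s' ⟨W, _ | ⟨v, S⟩, k, h', ht, rfl⟩ hlt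
    · rw [h'.height, List.length_nil] at hlt
      exact absurd hlt (Nat.not_lt_zero _)
    · have hv : v ∈ Wᶜ := Finset.mem_compl.2 (ht.notMem_visited v List.mem_cons_self)
      refine ⟨visitTime G r adj N v, ∑ u ∈ (insert v W)ᶜ, (visitTime G r adj N u + 1) + 1, ?_,
        (run_traverseBody hG hadj hN hB ht h').mono le_rfl fun s'' h'' =>
          ⟨_, _, _, h'', ht.visit hG (isChildLists_childLists hG hadj), rfl⟩⟩
      rw [Finset.compl_insert, ← Finset.add_sum_erase _ _ hv]
      omega
  · rintro τ s' ⟨W, S, k, h', ht, rfl⟩ hge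
    obtain rfl : S = [] := by
      rwa [h'.height, h'.consts.zero, List.length_pos_iff, not_not] at hge
    exact ⟨Nat.le_add_left .., h'.consts, fun v => h'.visited v (ht.mem_of_nil hG v)⟩

theorem sum_visitTime_le (hG : G.IsTree) (hadj : IsAdjLists G adj) :
    ∑ v, (visitTime G r adj N v + 1) ≤ 70 * n + leafCount G r * (19 * Nat.sqrt (N - 1)) := by
  have sum_leaf : ∑ v, (if childLists G r adj v = [] then 19 * Nat.sqrt (N - 1) else 0)
      = leafCount G r * (19 * Nat.sqrt (N - 1)) := by
    classical
    simp only [(isChildLists_childLists hG hadj).eq_nil_iff_isLeaf]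
    rw [← Finset.sum_filter, Finset.sum_const, smul_eq_mul, leafCount, Set.ncard_eq_toFinset_card']
    simp
  have := hadj.sum_length_add_two hG
  simp only [visitTime, Finset.sum_add_distrib, sum_leaf, ← Finset.mul_sum, Finset.sum_const,
    Finset.card_univ, Fintype.card_fin, smul_eq_mul]
  omega

end Visit

end RAM

/-! ### The program for the drawing -/

namespace RAM

open Fractions RootedTree Drawing

variable {B n N : ℕ} {G : SimpleGraph (Fin n)} {r : Fin n} {adj : Fin n → List (Fin n)} {s : State}

/-- The memory holds the input, and the first registers hold the size, the root, the number `x` and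
the number one. -/
structure Loaded (adj : Fin n → List (Fin n)) (r : Fin n) (x : ℕ) (s : State) : Prop where
  input : ∀ a, s.mem a = (encode adj r).getD a 0
  size : s.reg 1 = n
  root : s.reg 2 = r
  value : s.reg 3 = x
  one : s.reg 4 = 1

theorem Loaded.of_mem_eq {x : ℕ} {s' : State} (h : Loaded adj r x s) (hmem : s'.mem = s.mem)
    (hreg : EqBelow 5 s s') : Loaded adj r x s' where
  input := hmem ▸ h.input
  size := (hreg 1 (by norm_num)).trans h.size
  root := (hreg 2 (by norm_num)).trans h.root
  value := (hreg 3 (by norm_num)).trans h.value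
  one := (hreg 4 (by norm_num)).trans h.one

theorem Loaded.setReg {x : ℕ} (h : Loaded adj r x s) (y : ℕ) : Loaded adj r y (s.setReg 3 y) :=
  ⟨h.input, h.size, h.root, rfl, h.one⟩

theorem length_childLists (hG : G.IsTree) (hadj : IsAdjLists G adj) (v : Fin n) :
    (childLists G r adj v).length = (adj v).length - if v = r then 0 else 1 := by
  have parent_mem_iff : parent G r v ∈ adj v ↔ v ≠ r := by
    rw [(hadj v).2]
    refine ⟨fun h hv => ?_, fun hv => (isChild_parent hG hv).1.symm⟩
    rw [hv, parent_root] at h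
    exact h.ne rfl
  have filter_eq : (adj v).filter (· ≠ parent G r v) = (adj v).erase (parent G r v) := by
    rw [(hadj v).1.erase_eq_filter]
    exact List.filter_congr fun w _ => by rw [Bool.eq_iff_iff, decide_eq_true_iff, bne_iff_ne]
  rw [childLists, pushOrder, List.length_reverse, filter_eq, List.length_erase]
  simp only [parent_mem_iff]
  split_ifs <;> simp_all

theorem isLeaf_iff_length_lt (hG : G.IsTree) (hadj : IsAdjLists G adj) (v : Fin n) :
    IsLeaf G r v ↔ (adj v).length < if v = r then 1 else 2 := by
  rw [← (isChildLists_childLists hG hadj).eq_nil_iff_isLeaf, ← List.length_eq_zero_iff,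
    length_childLists hG hadj]
  split_ifs <;> omega

/-- The number of leaves among the vertices below `k`. -/
noncomputable def leafCountBelow (G : SimpleGraph (Fin n)) (r : Fin n) (k : ℕ) : ℕ :=
  {v : Fin n | v < k ∧ IsLeaf G r v}.ncard

theorem leafCountBelow_zero : leafCountBelow G r 0 = 0 := by simp [leafCountBelow]

theorem leafCountBelow_card : leafCountBelow G r n = leafCount G r := by
  simp [leafCountBelow, leafCount]

theorem leafCountBelow_le (k : ℕ) : leafCountBelow G r k ≤ n := by
  simpa [leafCountBelow] using Set.ncard_le_card {v : Fin n | v < k ∧ IsLeaf G r v}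

open Classical in
theorem leafCountBelow_succ (v : Fin n) : leafCountBelow G r (v + 1) =
    if IsLeaf G r v then leafCountBelow G r v + 1 else leafCountBelow G r v := by
  have lt_succ_iff (u : Fin n) : u.val < v + 1 ↔ u = v ∨ u.val < v := by
    rw [Nat.lt_succ_iff_lt_or_eq, or_comm, Fin.val_inj]
  simp only [leafCountBelow, lt_succ_iff, or_and_right, Set.ofPred_or]
  split_ifs with hv
  · rw [← Set.ncard_insert_of_notMem (a := v) (by simp)]
    congr 1
    ext u
    aesop
  · congr 1
    ext u
    aesop

/-- Load the degree of the vertex `R 12` and the smallest degree at which it is not a leaf. -/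
def leafTestProg : Prog := block [
  lookupProg, .op .sub 18 15 17, .const 19 1, ifNe 12 2 (.const 19 2)]

/-- Count the vertex `R 12` if it is a leaf, and go to the next vertex. -/
def countBody : Prog := block [
  leafTestProg, .cond 18 19 (.op .add 3 3 4) .skip, .op .add 12 12 4]

/-- Compute the bound for the coordinates of the vectors from the number of leaves. -/
def boundProg : Prog := block [
  .const 4 1, .load 1 0, .load 2 4, .loop 12 1 countBody,
  .const 18 13, .op .mul 3 3 18, .const 18 2, .op .div 3 3 18]

theorem run_leafTestProg {x : ℕ} {v : Fin n} (hG : G.IsTree) (hadj : IsAdjLists G adj)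
    (hB : 8 * n ≤ B) (h : Loaded adj r x s) (vertex : s.reg 12 = v) :
    Run B leafTestProg s 12 fun s' => s'.mem = s.mem ∧ EqBelow 15 s s' ∧
      (s'.reg 18 < s'.reg 19 ↔ IsLeaf G r v) := by
  have offset_le_word (k : ℕ) (hk : k ≤ n) : offset adj k ≤ B := by
    have := offset_le hG hadj hk
    omega
  refine .cons 6 6 ((run_lookupProg hB h.one vertex
    ((h.input _).trans (encode_offset adj r v.is_lt.le))
    ((h.input _).trans (encode_offset adj r v.is_lt))
    (offset_le_word _ v.is_lt.le) (offset_le_word _ v.is_lt)).mono le_rfl ?_) le_rfl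
  rintro s₁ ⟨mem, reg, last, -, first⟩
  have degree_le : (adj v).length ≤ B :=
    (Nat.le_add_left _ _).trans (offset_succ adj v ▸ offset_le_word (v + 1) v.is_lt)
  refine .cons_op (adj v).length (by simp [BinOp.eval, last, first, offset_succ]) degree_le ?_
  refine .cons_const (by have := v.pos; omega) ?_
  have root_eq : s₁.reg 2 = r := (reg 2 (by norm_num)).trans h.root
  have vertex_eq : s₁.reg 12 = v := (reg 12 (by norm_num)).trans vertex
  simp only [isLeaf_iff_length_lt hG hadj]
  refine .cons 3 1 (.ifNe le_rfl (fun hne => ?_) fun heq => ?_) le_rfl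
  · have hv : v ≠ r := by
      rintro rfl
      exact hne (by simp [root_eq, vertex_eq])
    refine ⟨_, 1, .const _ 19 2 (by have := v.pos; omega), le_rfl, .nil ⟨mem, ?_, ?_⟩⟩
    · simpa using reg
    · simp [hv]
  · obtain rfl : v = r := Fin.ext (by simpa [root_eq, vertex_eq] using heq)
    exact .nil ⟨mem, by simpa using reg, by simp⟩

theorem run_countBody (hG : G.IsTree) (hadj : IsAdjLists G adj) (hB : 8 * n ≤ B) {v : Fin n}
    (h : Loaded adj r (leafCountBelow G r v) s) (vertex : s.reg 12 = v) :
    Run B countBody s 16 fun s' =>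
      Loaded adj r (leafCountBelow G r (v + 1)) s' ∧ s'.reg 12 = v + 1 := by
  refine .cons 12 4 ((run_leafTestProg hG hadj hB h vertex).mono le_rfl ?_) le_rfl
  rintro s₁ ⟨mem, reg, isLeaf_iff⟩
  have h₁ := h.of_mem_eq mem (reg.mono (by norm_num))
  have advance {s₂ : State} (h₂ : Loaded adj r (leafCountBelow G r (v + 1)) s₂)
      (vertex₂ : s₂.reg 12 = v) : Run B (block [.op .add 12 12 4]) s₂ 2 fun s' =>
        Loaded adj r (leafCountBelow G r (v + 1)) s' ∧ s'.reg 12 = v + 1 :=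
    .cons_op (v + 1) (by simp [BinOp.eval, vertex₂, h₂.one]) (by omega)
      (.nil ⟨h₂.of_mem_eq rfl (by simp), by simp⟩)
  have vertex₁ : s₁.reg 12 = v := (reg 12 (by norm_num)).trans vertex
  refine .cons 2 2 (.cond (fun hlt => ?_) fun hge => ?_) le_rfl
  · have count := leafCountBelow_succ (G := G) (r := r) v
    rw [if_pos (isLeaf_iff.1 hlt)] at count
    have eval_eq : BinOp.add.eval (s₁.reg 3) (s₁.reg 4) = leafCountBelow G r (v + 1) := by
      rw [count, h₁.value, h₁.one]; rfl
    have := leafCountBelow_le (G := G) (r := r) (v + 1)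
    exact ⟨_, 1, .op _ .add 3 3 4 (by omega), le_rfl,
      advance (eval_eq ▸ h₁.setReg _) (by simpa using vertex₁)⟩
  · have count := leafCountBelow_succ (G := G) (r := r) v
    rw [if_neg (isLeaf_iff.not.1 hge)] at count
    exact .skip le_rfl (advance (count ▸ h₁) vertex₁)

theorem run_boundProg (hG : G.IsTree) (hadj : IsAdjLists G adj) (hB : 13 * n ≤ B) :
    Run B boundProg (State.init (encode adj r)) (17 * n + 9) (Loaded adj r (coordBound G r)) := by
  have hn : 0 < n := r.pos
  refine .cons_const (by omega) ?_
  refine .cons_load n (encode_zero adj r) (by omega) ?_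
  refine .cons_load r (encode_one adj r) (by omega) ?_
  refine .cons (n * (16 + 1) + 1) 5 ((Run.for_loop
    (fun k s => Loaded adj r (leafCountBelow G r k) s ∧ s.reg 12 = k) n 16 ?_ ?_ ?_).mono
    le_rfl ?_) (by omega)
  · rintro k - s ⟨h, vertex⟩
    rw [h.size, vertex]
  · rintro k hk s ⟨h, vertex⟩
    exact run_countBody (v := ⟨k, hk⟩) hG hadj (by omega) h vertex
  · exact ⟨⟨fun _ => rfl, rfl, rfl, leafCountBelow_zero.symm, rfl⟩, rfl⟩
  · rintro s ⟨h, -⟩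
    rw [leafCountBelow_card] at h
    have count_le : leafCount G r ≤ n := leafCount_le_card.trans_eq (Fintype.card_fin n)
    refine .cons_const (by omega) ?_
    refine .cons_op (13 * leafCount G r) (by simp [BinOp.eval, h.value, mul_comm]) (by omega) ?_
    refine .cons_const (by omega) ?_
    refine .cons_op (coordBound G r) (by simp [BinOp.eval, coordBound])
      (by rw [coordBound]; omega) (.nil ?_)
    exact ⟨h.input, h.size, h.root, rfl, h.one⟩

/-- Set up the constants of the traversal, the fraction `0 / 1`, the coordinates of the root, and
the stack, which holds the root as a child of itself. -/
def startProg : Prog := block [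
  .const 0 0, .op .add 8 1 1, .op .add 5 8 8, .op .add 6 5 1, .op .add 7 6 1, .op .add 8 7 1,
  .const 9 3, .op .add 9 9 1, .const 10 1, .const 11 0, .const 16 1, .store 8 2,
  .op .add 18 5 2, .store 18 2, .op .add 18 6 2, .store 18 0, .op .add 18 7 2, .store 18 0]

theorem run_startProg (hB : 8 * n ≤ B) (h : Loaded adj r N s) :
    Run B startProg s 19 (Represents G r adj N ∅ [r] 0) := by
  have hr := r.is_lt
  refine .cons_const (by omega) ?_
  refine .cons_op (2 * n) (by simp [BinOp.eval, h.size, two_mul]) (by omega) ?_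
  refine .cons_op (4 * n) (by simp [BinOp.eval]; omega) (by omega) ?_
  refine .cons_op (5 * n) (by simp [BinOp.eval, h.size]; omega) (by omega) ?_
  refine .cons_op (6 * n) (by simp [BinOp.eval, h.size]; omega) (by omega) ?_
  refine .cons_op (7 * n) (by simp [BinOp.eval, h.size]; omega) (by omega) ?_
  refine .cons_const (by omega) ?_
  refine .cons_op (n + 3) (by simp [BinOp.eval, h.size, add_comm]) (by omega) ?_
  refine .cons_const (by omega) ?_
  refine .cons_const (by omega) ?_
  refine .cons_const (by omega) ?_
  refine .cons_store (7 * n) r (by simp) (by simp [h.root]) (by omega) ?_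
  refine .cons_op (4 * n + r) (by simp [BinOp.eval, h.root]) (by omega) ?_
  refine .cons_store (4 * n + r) r (by simp) (by simp [h.root]) (by omega) ?_
  refine .cons_op (5 * n + r) (by simp [BinOp.eval, h.root]) (by omega) ?_
  refine .cons_store (5 * n + r) 0 (by simp) (by simp) (by omega) ?_
  refine .cons_op (6 * n + r) (by simp [BinOp.eval, h.root]) (by omega) ?_
  refine .cons_store (6 * n + r) 0 (by simp) (by simp) (by omega) ?_
  refine .nil ⟨?_, fun a ha => ?_, rfl, rfl, ⟨?_, trivial⟩, ?_, by simp, fun _ => ?_⟩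
  · constructor <;> simp [h.size, h.value, h.one]
  · have ne_ordinate : a ≠ 6 * n + r := by omega
    have ne_abscissa : a ≠ 5 * n + r := by omega
    have ne_parent : a ≠ 4 * n + r := by omega
    have ne_stack : a ≠ 7 * n := by omega
    simp [ne_ordinate, ne_abscissa, ne_parent, ne_stack, h.input]
  · have ne_ordinate : 7 * n ≠ 6 * n + r := by omega
    have ne_abscissa : 7 * n ≠ 5 * n + r := by omega
    have ne_parent : 7 * n ≠ 4 * n + r := by omega
    simp [ne_ordinate, ne_abscissa, ne_parent]
  · simp [parent_root, r.pos.ne']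
  · simp [State.coordinates]

/-- Copy the coordinates of the vertex `R 12` to the output, and go to the next vertex. -/
def copyBody : Prog := block [
  .op .add 18 6 12, .load 19 18, .op .add 20 12 12, .store 20 19,
  .op .add 18 7 12, .load 19 18, .op .add 20 20 4, .store 20 19, .op .add 12 12 4]

/-- The coordinates of the vertices below `k` have been copied. -/
structure Copied (P : Fin n → ℕ × ℕ) (N k : ℕ) (s : State) : Prop where
  consts : Consts n N s
  vertex : s.reg 12 = k
  coordinates : ∀ v : Fin n, s.coordinates n v = P v
  copied : ∀ v : Fin n, v < k → (s.mem (2 * v), s.mem (2 * v + 1)) = P v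

theorem run_copyBody {P : Fin n → ℕ × ℕ} (hB : 8 * n ≤ B) {v : Fin n} (hP : P v ≤ (B, B))
    (h : Copied P N v s) : Run B copyBody s 10 (Copied P N (v + 1)) := by
  have hv := v.is_lt
  obtain ⟨abscissa, ordinate⟩ := Prod.ext_iff.1 (h.coordinates v)
  simp only [State.coordinates] at abscissa ordinate
  refine .cons_op (5 * n + v) (by simp [BinOp.eval, h.vertex, h.consts.abscissas]) (by omega) ?_
  refine .cons_load (P v).1 (by simpa using abscissa) hP.1 ?_
  refine .cons_op (2 * v) (by simp [BinOp.eval, h.vertex, two_mul]) (by omega) ?_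
  refine .cons_store (2 * v) (P v).1 (by simp) (by simp) hP.1 ?_
  refine .cons_op (6 * n + v) (by simp [BinOp.eval, h.vertex, h.consts.ordinates]) (by omega) ?_
  have ne_output : 6 * n + v ≠ 2 * v := by omega
  refine .cons_load (P v).2 (by simpa [ne_output] using ordinate) hP.2 ?_
  refine .cons_op (2 * v + 1) (by simp [BinOp.eval, h.consts.one]) (by omega) ?_
  refine .cons_store (2 * v + 1) (P v).2 (by simp) (by simp) hP.2 ?_
  refine .cons_op (v + 1) (by simp [BinOp.eval, h.vertex, h.consts.one]) (by omega) (.nil ?_)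
  refine ⟨h.consts.of_eqBelow (m := 12) (by simp) (by norm_num), by simp, fun u => ?_,
    fun u hu => ?_⟩
  · rw [← h.coordinates u]
    simp only [State.coordinates, State.mem_setReg, State.mem_setMem]
    rw [if_neg (by omega), if_neg (by omega), if_neg (by omega), if_neg (by omega)]
  · simp only [State.mem_setReg, State.mem_setMem]
    obtain rfl | hne := eq_or_ne u v
    · simp
    · have := Fin.val_ne_of_ne hne
      rw [← h.copied u (by omega), if_neg (by omega), if_neg (by omega), if_neg (by omega),
        if_neg (by omega)]

theorem run_copy {P : Fin n → ℕ × ℕ} (hB : 8 * n ≤ B) (hP : ∀ v, P v ≤ (B, B))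
    (hs : Consts n N s) (hv : s.reg 12 = 0) (h : ∀ v : Fin n, s.coordinates n v = P v) :
    Run B (.loop 12 1 copyBody) s (n * (10 + 1) + 1) fun s' =>
      (s'.output : Fin n → ℤ × ℤ) = fun v => natPoint (P v) := by
  refine (Run.for_loop (Copied P N) n 10 ?_ ?_ ⟨hs, hv, h, by simp⟩).mono le_rfl ?_
  · rintro k - s' h'
    rw [h'.consts.size, h'.vertex]
  · intro k hk s' h'
    exact run_copyBody (v := ⟨k, hk⟩) hB (hP _) h'
  · intro s' h'
    funext v
    rw [← h'.copied v v.is_lt]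
    rfl

/-- Compute the drawing of a rooted tree. -/
def drawProg : Prog := block [
  boundProg, startProg, .loop 0 16 traverseBody, .const 12 0, .loop 12 1 copyBody]

theorem coordBound_succ_le (hG : G.IsTree) : coordBound G r + 1 ≤ 8 * n := by
  have := leafCount_pos (r := r) hG
  have : leafCount G r ≤ n := leafCount_le_card.trans_eq (Fintype.card_fin n)
  rw [coordBound]
  omega

theorem run_drawProg (hG : G.IsTree) (hadj : IsAdjLists G adj) (hB : 2048 * n ^ 3 ≤ B) :
    Run B drawProg (State.init (encode adj r))
      (131 * n + leafCount G r * (19 * Nat.sqrt (coordBound G r - 1))) fun s =>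
        (s.output : Fin n → ℤ × ℤ) = gridPos G r (childLists G r adj) := by
  have hn : 0 < n := r.pos
  have le_cube : n ≤ n ^ 3 := Nat.le_self_pow (by norm_num) n
  have hN := coordBound_succ_le (r := r) hG
  have traverse_le := sum_visitTime_le (N := coordBound G r) (r := r) hG hadj
  set τ := ∑ v, (visitTime G r adj (coordBound G r) v + 1)
  refine .cons (17 * n + 9) (19 + (τ + 1 + (11 * n + 3)))
    ((run_boundProg hG hadj (by omega)).mono le_rfl fun s₁ h₁ => ?_) (by omega)
  refine .cons 19 _ ((run_startProg (G := G) (by omega) h₁).mono le_rfl fun s₂ h₂ => ?_) le_rfl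
  refine .cons (τ + 1) _ ((run_traverse hG hadj hN hB h₂).mono le_rfl ?_) le_rfl
  rintro s₃ ⟨consts₃, coordinates₃⟩
  have position_le_word (v : Fin n) :
      position G r (childLists G r adj) (coordBound G r) v ≤ (B, B) :=
    (position_le hG hN _ v).trans ⟨by omega, by omega⟩
  refine .cons_const (Nat.zero_le B) ?_
  refine .cons (n * (10 + 1) + 1) 1 ((run_copy (s := s₃.setReg 12 0) (by omega) position_le_word
    (consts₃.of_eqBelow (m := 12) (by simp) (by norm_num)) rfl coordinates₃).mono le_rfl
    fun s₄ h₄ => .nil h₄) (by omega)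

theorem mul_sqrt_le_rpow (t : ℕ) :
    ((t * Nat.sqrt (13 * t / 2 - 1) : ℕ) : ℝ) ≤ 3 * (t : ℝ) ^ (3 / 2 : ℝ) := by
  have sqrt_le : (Nat.sqrt (13 * t / 2 - 1) : ℝ) ≤ 3 * √t := by
    rw [← Real.sqrt_sq (show (0 : ℝ) ≤ 3 by norm_num), ← Real.sqrt_mul (by norm_num)]
    refine Real.nat_sqrt_le_real_sqrt.trans (Real.sqrt_le_sqrt ?_)
    have : 13 * t / 2 - 1 ≤ 3 ^ 2 * t := by omega
    exact_mod_cast this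
  calc ((t * Nat.sqrt (13 * t / 2 - 1) : ℕ) : ℝ) ≤ t * (3 * √t) := by
        rw [Nat.cast_mul]
        gcongr
    _ = 3 * ((t : ℝ) * (t : ℝ) ^ (1 / 2 : ℝ)) := by
        rw [Real.sqrt_eq_rpow]
        ring
    _ = 3 * (t : ℝ) ^ (3 / 2 : ℝ) := by
        rw [← Real.rpow_one_add' (by positivity) (by norm_num)]
        norm_num

theorem exists_exec_drawProg (hG : G.IsTree) (hadj : IsAdjLists G adj) (hB : 2048 * n ^ 3 ≤ B) :
    ∃ (s : State) (T : ℕ), Exec B drawProg (State.init (encode adj r)) s T ∧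
      (T : ℝ) ≤ 131 * ((n : ℝ) + (leafCount G r : ℝ) ^ (3 / 2 : ℝ)) ∧
      (s.output : Fin n → ℤ × ℤ) = gridPos G r (childLists G r adj) := by
  obtain ⟨s, T, exec, time_le, output⟩ := run_drawProg (r := r) hG hadj hB
  refine ⟨s, T, exec, ?_, output⟩
  have search_le := mul_sqrt_le_rpow (leafCount G r)
  have rpow_nonneg : (0 : ℝ) ≤ (leafCount G r : ℝ) ^ (3 / 2 : ℝ) := by positivity
  have time_le' : (T : ℝ) ≤ 131 * n +
      19 * (leafCount G r * Nat.sqrt (13 * leafCount G r / 2 - 1) : ℕ) := by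
    rw [mul_left_comm] at time_le
    exact_mod_cast time_le
  linarith

end RAM

theorem mainTheorem2 :
    -- every rooted tree has a truly integral Fáry embedding on the grid
    (∀ (V : Type u) [Fintype V] (G : SimpleGraph V) (r : V), G.IsTree →
      ∃ pos : V → ℤ × ℤ, Drawing.IsTrulyIntegralFary G pos ∧
        Drawing.OnGrid pos
          (max 1 (2 * Real.pi ^ 2 / 3 * RootedTree.leafCount G r * RootedTree.depth G r))
          (max 1 (2 * Real.pi ^ 2 / 3 * RootedTree.leafCount G r * RootedTree.depth G r))) ∧
    -- the grid has size `O(n²) × O(n²)`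
    (∃ K : ℝ, ∀ (V : Type u) [Fintype V] (G : SimpleGraph V) (r : V), G.IsTree →
      max 1 (2 * Real.pi ^ 2 / 3 * RootedTree.leafCount G r * RootedTree.depth G r)
        ≤ K * (Fintype.card V : ℝ) ^ 2) ∧
    -- one program finds such an embedding in time `O(n + t^(3/2))`, with words of `O(log n)` bits
    (∃ (p : RAM.Prog) (C D : ℕ), ∀ (n : ℕ) (G : SimpleGraph (Fin n)) (r : Fin n)
      (adj : Fin n → List (Fin n)), G.IsTree → RAM.IsAdjLists G adj →
      ∃ (s : RAM.State) (T : ℕ),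
        RAM.Exec (D * n ^ D) p (RAM.State.init (RAM.encode adj r)) s T ∧
        (T : ℝ) ≤ C * ((n : ℝ) + (RootedTree.leafCount G r : ℝ) ^ (3 / 2 : ℝ)) ∧
        Drawing.IsTrulyIntegralFary G (s.output : Fin n → ℤ × ℤ) ∧
        Drawing.OnGrid (s.output : Fin n → ℤ × ℤ)
          (max 1 (2 * Real.pi ^ 2 / 3 * RootedTree.leafCount G r * RootedTree.depth G r))
          (max 1 (2 * Real.pi ^ 2 / 3 * RootedTree.leafCount G r * RootedTree.depth G r))) := by
  refine ⟨fun V _ G r hG => ?_, ⟨11, fun V _ G r hG => Drawing.gridSize_le hG⟩,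
    RAM.drawProg, 131, 2048, fun n G r adj hG hadj => ?_⟩
  · obtain ⟨ch, hch⟩ := Drawing.exists_isChildLists G r
    exact ⟨Drawing.gridPos G r ch, Drawing.isTrulyIntegralFary_gridPos hG hch,
      Drawing.onGrid_gridPos hG hch⟩
  · have hch := RAM.isChildLists_childLists (r := r) hG hadj
    have word_bound (D : ℕ) (hD : 3 ≤ D) : 2048 * n ^ 3 ≤ 2048 * n ^ D := by
      gcongr
      exact r.pos
    obtain ⟨s, T, exec, time_le, output⟩ :=
      RAM.exists_exec_drawProg (r := r) hG hadj (word_bound 2048 (by norm_num))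
    refine ⟨s, T, exec, mod_cast time_le, ?_⟩
    rw [output]
    exact ⟨Drawing.isTrulyIntegralFary_gridPos hG hch, Drawing.onGrid_gridPos hG hch⟩
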